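/- Let $\mathbb K$ be a field and let $d\ge 0$ be an integer; index rows and columns of matrices in $\mathrm{Mat}_{d+1}(\mathbb K)$ by $0,\dots,d$. **TH systems.** Let $V$ be a $\mathbb K$-vector space of dimension $d+1$. An element of $\mathrm{End}(V)$ is *multiplicity-free* if its eigenspaces span $V$ and each has dimension one; its primitive idempotent for an eigenvalue $\theta$ is the identity on the $\theta$-eigenspace and zero on the other eigenspaces. A *TH system* over $\mathbb K$ of diameter $d$ is a sequence $\Phi=(A;\{E_i\}_{i=0}^d;A^*;\{E_i^*\}_{i=0}^d)$ in $\mathrm{End}(V)$, for some such $V$, where $A,A^*$ are multiplicity-free, $\{E_i\}$ (resp. $\{E_i^*\}$) is an ordering of the primitive idempotents of $A$ (resp. $A^*$), and each of $E_iA^*E_j$, $E_i^*AE_j^*$ is zero if $i-j>1$ and nonzero if $i-j=1$. Let $\theta_i$ (resp. $\theta_i^*$) be the eigenvalue of $A$ (resp. $A^*$) for $E_i$ (resp. $E_i^*$). An isomorphism from $\Phi$ (on $V$) to $\Psi$ (on $W$) is a $\mathbb K$-algebra isomorphism $\mathrm{End}(V)\to\mathrm{End}(W)$ carrying each member of $\Phi$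 to the corresponding member of $\Psi$. For $\alpha,\beta,\alpha^*,\beta^*\in\mathbb K$ with $\alpha,\alpha^*\neq 0$, the sequence $(\alpha A+\beta I;\{E_i\};\alpha^*A^*+\beta^*I;\{E_i^*\})$ is an *affine transformation* of $\Phi$; TH systems $\Phi,\Phi'$ are *affine isomorphic* if $\Phi$ is isomorphic to an affine transformation of $\Phi'$. **The matrix $\mathcal P$.** Put $U_i=(E_0^*V+\cdots+E_i^*V)\cap(E_0V+\cdots+E_{d-i}V)$. For $1\le i\le d$ the space $U_i$ is nonzero and $(A-\theta_{d-i+1}I)(A^*-\theta_i^*I)$ acts on it as a nonzero scalar, denoted $\phi_i$. Let $\mathcal P\in\mathrm{Mat}_{d+1}(\mathbb K)$ have entries $$\mathcal P_{ij}=\sum_{h=0}^{d}\frac{(\theta_i-\theta_d)(\theta_i-\theta_{d-1})\cdots(\theta_i-\theta_{d-h+1})\,(\theta_j^*-\theta_0^*)(\theta_j^*-\theta_1^*)\cdots(\theta_j^*-\theta_{h-1}^*)}{\phi_1\phi_2\cdots\phi_h}.$$ **Vandermonde systems.** A sequence of polynomials $\{f_i\}_{i=0}^d$ in $\mathbb K[\lambda]$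 is *graded* if $f_0=1$ and $\deg f_i=i$. A *normalized west-south Vandermonde system* in $\mathrm{Mat}_{d+1}(\mathbb K)$ is a sequence $(X,\{\theta_i\}_{i=0}^d,\{\theta_i^*\}_{i=0}^d)$ where $X\in\mathrm{Mat}_{d+1}(\mathbb K)$, the $\theta_i\in\mathbb K$ are mutually distinct, the $\theta_i^*\in\mathbb K$ are mutually distinct, $X_{i0}=X_{di}=1$ for all $i$, and there are graded sequences $\{f_i\}$, $\{f_i^*\}$ with $X_{ij}=f_j(\theta_i)=f^*_{d-i}(\theta_j^*)$ for $0\le i,j\le d$. Two such systems are *affine related* (lie in the same *affine class*) if one has the form $(X,\{\alpha\theta_i+\beta\},\{\alpha^*\theta_i^*+\beta^*\})$ for the other $(X,\{\theta_i\},\{\theta_i^*\})$, with $\alpha,\beta,\alpha^*,\beta^*\in\mathbb K$ and $\alpha,\alpha^*\neq 0$. **Statement.** Sending a TH system $\Phi$ to $(\mathcal P,\{\theta_i\}_{i=0}^d,\{\theta_i^*\}_{i=0}^d)$ gives a well-defined bijection $\rho$ from the set of isomorphism classes of TH systems over $\mathbb K$ of diameter $d$ to the set of normalized west-south Vandermonde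 systems in $\mathrm{Mat}_{d+1}(\mathbb K)$, and $\rho$ induces a bijection from the set of affine isomorphism classes of TH systems over $\mathbb K$ of diameter $d$ to the set of affine classes of normalized west-south Vandermonde systems in $\mathrm{Mat}_{d+1}(\mathbb K)$: the affine isomorphism class of $\Phi$ is sent to the affine class of the image under $\rho$ of the isomorphism class of $\Phi$. -/

import Mathlib

open Polynomial

universe u

section LinearAlgebra

variable {K : Type*} [Field K] {V : Type*} [AddCommGroup V] [Module K V] {d : ℕ}

/-- `A` is multiplicity-free: the eigenspaces of `A` span `V` and each of them has dimension one. -/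
def IsMultiplicityFree (A : Module.End K V) : Prop :=
  (⨆ μ : K, A.eigenspace μ) = ⊤ ∧
    ∀ μ : K, A.HasEigenvalue μ → Module.finrank K (A.eigenspace μ) = 1

/-- `θ 0, …, θ d` is an ordering (without repetition) of the eigenvalues of `A`, and `E i` is the
primitive idempotent of `A` for `θ i`: it is the identity on the eigenspace of `θ i` and it
vanishes on the other eigenspaces. -/
structure IsPrimitiveIdempotentOrdering (A : Module.End K V) (θ : Fin (d + 1) → K)
    (E : Fin (d + 1) → Module.End K V) : Prop where
  injective : Function.Injective θ
  hasEigenvalue_iff : ∀ μ : K, A.HasEigenvalue μ ↔ ∃ i, θ i = μ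
  apply_self : ∀ i, ∀ v ∈ A.eigenspace (θ i), E i v = v
  apply_ne : ∀ i j, j ≠ i → ∀ v ∈ A.eigenspace (θ j), E i v = 0

/-- `E i * B * E j` is zero if `i - j > 1` and nonzero if `i - j = 1`. -/
def HessenbergCondition (E : Fin (d + 1) → Module.End K V) (B : Module.End K V) : Prop :=
  ∀ i j : Fin (d + 1),
    ((j : ℕ) + 1 < (i : ℕ) → E i * B * E j = 0) ∧
    ((i : ℕ) = (j : ℕ) + 1 → E i * B * E j ≠ 0)

theorem mem_eigenspace_affine_iff (A : Module.End K V) {α : K} (hα : α ≠ 0) (β μ : K) (v : V) :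
    v ∈ (α • A + β • (1 : Module.End K V)).eigenspace (α * μ + β) ↔ v ∈ A.eigenspace μ := by
  simp only [Module.End.mem_eigenspace_iff, LinearMap.add_apply, LinearMap.smul_apply,
    Module.End.one_apply, add_smul, mul_smul, add_left_inj]
  exact (smul_right_injective V hα).eq_iff

theorem eigenspace_affine (A : Module.End K V) {α : K} (hα : α ≠ 0) (β μ : K) :
    (α • A + β • (1 : Module.End K V)).eigenspace (α * μ + β) = A.eigenspace μ :=
  Submodule.ext fun v => mem_eigenspace_affine_iff A hα β μ v

theorem eigenspace_affine' (A : Module.End K V) {α : K} (hα : α ≠ 0) (β μ : K) :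
    (α • A + β • (1 : Module.End K V)).eigenspace μ = A.eigenspace (α⁻¹ * (μ - β)) := by
  rw [← eigenspace_affine A hα β (α⁻¹ * (μ - β))]
  congr 1
  field_simp
  ring

theorem IsMultiplicityFree.affine {A : Module.End K V} (h : IsMultiplicityFree A) {α : K}
    (hα : α ≠ 0) (β : K) : IsMultiplicityFree (α • A + β • (1 : Module.End K V)) := by
  refine ⟨?_, ?_⟩
  · rw [eq_top_iff, ← h.1]
    refine iSup_le fun μ => ?_
    rw [← eigenspace_affine A hα β μ]
    exact le_iSup (fun ν : K => (α • A + β • (1 : Module.End K V)).eigenspace ν) (α * μ + β)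
  · intro μ hμ
    rw [Module.End.hasEigenvalue_iff, eigenspace_affine' A hα β μ] at hμ
    rw [eigenspace_affine' A hα β μ]
    exact h.2 _ (Module.End.hasEigenvalue_iff.2 hμ)

theorem IsPrimitiveIdempotentOrdering.affine {A : Module.End K V} {θ : Fin (d + 1) → K}
    {E : Fin (d + 1) → Module.End K V} (h : IsPrimitiveIdempotentOrdering A θ E) {α : K}
    (hα : α ≠ 0) (β : K) :
    IsPrimitiveIdempotentOrdering (α • A + β • (1 : Module.End K V))
      (fun i => α * θ i + β) E where
  injective := fun i j hij => h.injective (mul_left_cancel₀ hα (add_right_cancel hij))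
  hasEigenvalue_iff := fun μ => by
    rw [Module.End.hasEigenvalue_iff, eigenspace_affine' A hα β μ,
      ← Module.End.hasEigenvalue_iff, h.hasEigenvalue_iff]
    refine exists_congr fun i => ⟨fun hi => ?_, fun hi => ?_⟩
    · rw [hi]
      field_simp
      ring
    · rw [← hi]
      field_simp
      ring
  apply_self := fun i v hv => h.apply_self i v ((mem_eigenspace_affine_iff A hα β _ v).1 hv)
  apply_ne := fun i j hij v hv =>
    h.apply_ne i j hij v ((mem_eigenspace_affine_iff A hα β _ v).1 hv)

theorem IsPrimitiveIdempotentOrdering.mul_eq_zero {A : Module.End K V} {θ : Fin (d + 1) → K}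
    {E : Fin (d + 1) → Module.End K V} (h : IsPrimitiveIdempotentOrdering A θ E)
    (hA : IsMultiplicityFree A) {i j : Fin (d + 1)} (hij : i ≠ j) : E i * E j = 0 := by
  have key : (⨆ μ : K, A.eigenspace μ) ≤ LinearMap.ker (E i * E j) := by
    refine iSup_le fun μ v hv => ?_
    rw [LinearMap.mem_ker, Module.End.mul_apply]
    by_cases hv0 : v = 0
    · simp [hv0]
    obtain ⟨k, rfl⟩ := (h.hasEigenvalue_iff μ).1
      (Module.End.hasEigenvalue_of_hasEigenvector ⟨hv, hv0⟩)
    by_cases hkj : k = j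
    · subst hkj
      rw [h.apply_self k v hv, h.apply_ne i k (Ne.symm hij) v hv]
    · rw [h.apply_ne j k hkj v hv, map_zero]
  rw [hA.1, top_le_iff, LinearMap.ker_eq_top] at key
  exact key

theorem HessenbergCondition.affine {A B : Module.End K V} {θ : Fin (d + 1) → K}
    {E : Fin (d + 1) → Module.End K V} (hE : IsPrimitiveIdempotentOrdering A θ E)
    (hA : IsMultiplicityFree A) (h : HessenbergCondition E B) {α : K} (hα : α ≠ 0) (β : K) :
    HessenbergCondition E (α • B + β • (1 : Module.End K V)) := by
  intro i j
  have key : i ≠ j →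
      E i * (α • B + β • (1 : Module.End K V)) * E j = α • (E i * B * E j) := by
    intro hij
    rw [mul_add, add_mul, mul_smul_comm, smul_mul_assoc, mul_smul_comm, smul_mul_assoc, mul_one,
      hE.mul_eq_zero hA hij, smul_zero, add_zero]
  refine ⟨fun hlt => ?_, fun heq => ?_⟩
  · rw [key (by rintro rfl; omega), (h i j).1 hlt, smul_zero]
  · rw [key (by rintro rfl; omega)]
    exact smul_ne_zero hα ((h i j).2 heq)

end LinearAlgebra

/-- A thin Hessenberg system `(A; E₀, …, E_d; A*; E*₀, …, E*_d)` over `K` of diameter `d`, on an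
arbitrary underlying vector space `V` of dimension `d + 1`. -/
structure THSystem (K : Type u) [Field K] (d : ℕ) where
  V : Type u
  [addCommGroup : AddCommGroup V]
  [module : Module K V]
  finrank_eq : Module.finrank K V = d + 1
  A : Module.End K V
  E : Fin (d + 1) → Module.End K V
  Astar : Module.End K V
  Estar : Fin (d + 1) → Module.End K V
  multiplicityFree : IsMultiplicityFree A
  multiplicityFree_star : IsMultiplicityFree Astar
  ordering : ∃ θ : Fin (d + 1) → K, IsPrimitiveIdempotentOrdering A θ E
  ordering_star : ∃ θs : Fin (d + 1) → K, IsPrimitiveIdempotentOrdering Astar θs Estar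
  hessenberg : HessenbergCondition E Astar
  hessenberg_star : HessenbergCondition Estar A

attribute [instance] THSystem.addCommGroup THSystem.module

namespace THSystem

variable {K : Type u} [Field K] {d : ℕ}

/-- Isomorphism of TH systems: a `K`-algebra isomorphism `End(V) → End(W)` that carries the
members of `Φ` to those of `Ψ`. -/
def Isomorphic (Φ Ψ : THSystem K d) : Prop :=
  ∃ γ : Module.End K Φ.V ≃ₐ[K] Module.End K Ψ.V,
    γ Φ.A = Ψ.A ∧ γ Φ.Astar = Ψ.Astar ∧
      (∀ i, γ (Φ.E i) = Ψ.E i) ∧ (∀ i, γ (Φ.Estar i) = Ψ.Estar i)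

theorem Isomorphic.refl (Φ : THSystem K d) : Isomorphic Φ Φ :=
  ⟨AlgEquiv.refl, rfl, rfl, fun _ => rfl, fun _ => rfl⟩

theorem Isomorphic.symm {Φ Ψ : THSystem K d} (h : Isomorphic Φ Ψ) : Isomorphic Ψ Φ := by
  obtain ⟨γ, h1, h2, h3, h4⟩ := h
  exact ⟨γ.symm, by rw [← h1, γ.symm_apply_apply], by rw [← h2, γ.symm_apply_apply],
    fun i => by rw [← h3, γ.symm_apply_apply], fun i => by rw [← h4, γ.symm_apply_apply]⟩

theorem Isomorphic.trans {Φ Ψ Ω : THSystem K d} (h : Isomorphic Φ Ψ) (h' : Isomorphic Ψ Ω) :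
    Isomorphic Φ Ω := by
  obtain ⟨γ, h1, h2, h3, h4⟩ := h
  obtain ⟨δ, k1, k2, k3, k4⟩ := h'
  exact ⟨γ.trans δ, by simp [h1, k1], by simp [h2, k2], fun i => by simp [h3, k3],
    fun i => by simp [h4, k4]⟩

/-- The affine transformation `(αA + βI; E; α*A* + β*I; E*)` of a TH system. -/
def affine (Φ : THSystem K d) (α β αs βs : K) (hα : α ≠ 0) (hαs : αs ≠ 0) : THSystem K d where
  V := Φ.V
  finrank_eq := Φ.finrank_eq
  A := α • Φ.A + β • (1 : Module.End K Φ.V)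
  E := Φ.E
  Astar := αs • Φ.Astar + βs • (1 : Module.End K Φ.V)
  Estar := Φ.Estar
  multiplicityFree := Φ.multiplicityFree.affine hα β
  multiplicityFree_star := Φ.multiplicityFree_star.affine hαs βs
  ordering := Φ.ordering.elim fun _ h => ⟨_, h.affine hα β⟩
  ordering_star := Φ.ordering_star.elim fun _ h => ⟨_, h.affine hαs βs⟩
  hessenberg := Φ.ordering.elim fun _ h => Φ.hessenberg.affine h Φ.multiplicityFree hαs βs
  hessenberg_star :=
    Φ.ordering_star.elim fun _ h => Φ.hessenberg_star.affine h Φ.multiplicityFree_star hα β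

/-- `Φ` and `Φ'` are affine isomorphic: `Φ` is isomorphic to an affine transformation of `Φ'`. -/
def AffineIsomorphic (Φ Φ' : THSystem K d) : Prop :=
  ∃ (α β αs βs : K) (hα : α ≠ 0) (hαs : αs ≠ 0), Isomorphic Φ (Φ'.affine α β αs βs hα hαs)

theorem Isomorphic.affine {Φ Ψ : THSystem K d} (h : Isomorphic Φ Ψ) (α β αs βs : K) (hα : α ≠ 0)
    (hαs : αs ≠ 0) :
    Isomorphic (Φ.affine α β αs βs hα hαs) (Ψ.affine α β αs βs hα hαs) := by
  obtain ⟨γ, h1, h2, h3, h4⟩ := h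
  refine ⟨γ, ?_, ?_, h3, h4⟩
  · change γ (α • Φ.A + β • 1) = α • Ψ.A + β • 1
    rw [map_add, map_smul, map_smul, map_one, h1]
  · change γ (αs • Φ.Astar + βs • 1) = αs • Ψ.Astar + βs • 1
    rw [map_add, map_smul, map_smul, map_one, h2]

theorem affine_affine (Φ : THSystem K d) (α β αs βs α' β' αs' βs' : K) (hα : α ≠ 0)
    (hαs : αs ≠ 0) (hα' : α' ≠ 0) (hαs' : αs' ≠ 0) :
    Isomorphic ((Φ.affine α β αs βs hα hαs).affine α' β' αs' βs' hα' hαs')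
      (Φ.affine (α' * α) (α' * β + β') (αs' * αs) (αs' * βs + βs')
        (mul_ne_zero hα' hα) (mul_ne_zero hαs' hαs)) := by
  refine ⟨AlgEquiv.refl, ?_, ?_, fun _ => rfl, fun _ => rfl⟩
  · change α' • (α • Φ.A + β • (1 : Module.End K Φ.V)) + β' • 1
      = (α' * α) • Φ.A + (α' * β + β') • 1
    module
  · change αs' • (αs • Φ.Astar + βs • (1 : Module.End K Φ.V)) + βs' • 1
      = (αs' * αs) • Φ.Astar + (αs' * βs + βs') • 1
    module

theorem affine_one_zero (Φ : THSystem K d) (α β αs βs : K) (hα : α ≠ 0) (hαs : αs ≠ 0)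
    (h1 : α = 1) (h2 : β = 0) (h3 : αs = 1) (h4 : βs = 0) :
    Isomorphic Φ (Φ.affine α β αs βs hα hαs) := by
  subst h1 h2 h3 h4
  refine ⟨AlgEquiv.refl, ?_, ?_, fun _ => rfl, fun _ => rfl⟩
  · change Φ.A = (1 : K) • Φ.A + (0 : K) • (1 : Module.End K Φ.V)
    module
  · change Φ.Astar = (1 : K) • Φ.Astar + (0 : K) • (1 : Module.End K Φ.V)
    module

theorem AffineIsomorphic.refl (Φ : THSystem K d) : AffineIsomorphic Φ Φ :=
  ⟨1, 0, 1, 0, one_ne_zero, one_ne_zero, affine_one_zero Φ _ _ _ _ _ _ rfl rfl rfl rfl⟩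

theorem AffineIsomorphic.symm {Φ Ψ : THSystem K d} (h : AffineIsomorphic Φ Ψ) :
    AffineIsomorphic Ψ Φ := by
  obtain ⟨α, β, αs, βs, hα, hαs, h⟩ := h
  refine ⟨α⁻¹, -(α⁻¹ * β), αs⁻¹, -(αs⁻¹ * βs), inv_ne_zero hα, inv_ne_zero hαs, ?_⟩
  refine Isomorphic.trans ?_ (h.symm.affine _ _ _ _ _ _)
  refine Isomorphic.trans ?_ (affine_affine Ψ _ _ _ _ _ _ _ _ _ _ _ _).symm
  exact affine_one_zero Ψ _ _ _ _ _ _ (inv_mul_cancel₀ hα) (add_neg_cancel _)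
    (inv_mul_cancel₀ hαs) (add_neg_cancel _)

theorem AffineIsomorphic.trans {Φ Ψ Ω : THSystem K d} (h : AffineIsomorphic Φ Ψ)
    (h' : AffineIsomorphic Ψ Ω) : AffineIsomorphic Φ Ω := by
  obtain ⟨α, β, αs, βs, hα, hαs, h⟩ := h
  obtain ⟨α', β', αs', βs', hα', hαs', h'⟩ := h'
  exact ⟨_, _, _, _, _, _, (h.trans (h'.affine _ _ _ _ _ _)).trans
    (affine_affine Ω _ _ _ _ _ _ _ _ _ _ _ _)⟩

/-- Isomorphism of TH systems as an equivalence relation. -/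
def isoSetoid (K : Type u) [Field K] (d : ℕ) : Setoid (THSystem K d) where
  r := Isomorphic
  iseqv := ⟨Isomorphic.refl, Isomorphic.symm, Isomorphic.trans⟩

/-- Affine isomorphism of TH systems as an equivalence relation. -/
def affineSetoid (K : Type u) [Field K] (d : ℕ) : Setoid (THSystem K d) where
  r := AffineIsomorphic
  iseqv := ⟨AffineIsomorphic.refl, AffineIsomorphic.symm, AffineIsomorphic.trans⟩

/-- The set of isomorphism classes of TH systems over `K` of diameter `d`. -/
def IsoClass (K : Type u) [Field K] (d : ℕ) : Type (u + 1) := Quotient (isoSetoid K d)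

/-- The set of affine isomorphism classes of TH systems over `K` of diameter `d`. -/
def AffineClass (K : Type u) [Field K] (d : ℕ) : Type (u + 1) := Quotient (affineSetoid K d)

/-- The isomorphism class of a TH system. -/
def isoClass (Φ : THSystem K d) : IsoClass K d := Quotient.mk (isoSetoid K d) Φ

/-- The affine isomorphism class of a TH system. -/
def affineClass (Φ : THSystem K d) : AffineClass K d := Quotient.mk (affineSetoid K d) Φ

/-- The component `U_i = (E*_0 V + ⋯ + E*_i V) ∩ (E_0 V + ⋯ + E_{d-i} V)` of the split
decomposition of `V`. -/
def splitSubspace (Φ : THSystem K d) (i : Fin (d + 1)) : Submodule K Φ.V :=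
  (⨆ h : Fin (d + 1), ⨆ _ : h ≤ i, LinearMap.range (Φ.Estar h)) ⊓
    (⨆ h : Fin (d + 1), ⨆ _ : h ≤ i.rev, LinearMap.range (Φ.E h))

/-- `(θ, θ*, φ)` is the parameter array of `Φ`: `θ` is the eigenvalue sequence, `θ*` is the dual
eigenvalue sequence, and `φ` is the split sequence. The sequence `φ_1, …, φ_d` is indexed by
`Fin d`, with `φ k` standing for `φ_{k+1}`. The scalar `φ_i` is the nonzero eigenvalue of
`(A - θ_{d-i+1} I)(A* - θ*_i I)` on the nonzero subspace `U_i`. -/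
structure IsParameterArray (Φ : THSystem K d) (θ θs : Fin (d + 1) → K) (φ : Fin d → K) :
    Prop where
  eigenvalues : IsPrimitiveIdempotentOrdering Φ.A θ Φ.E
  dualEigenvalues : IsPrimitiveIdempotentOrdering Φ.Astar θs Φ.Estar
  split_ne_bot : ∀ k : Fin d, Φ.splitSubspace k.succ ≠ ⊥
  split_apply : ∀ k : Fin d, ∀ x ∈ Φ.splitSubspace k.succ,
    ((Φ.A - θ k.castSucc.rev • (1 : Module.End K Φ.V)) *
      (Φ.Astar - θs k.succ • (1 : Module.End K Φ.V))) x = φ k • x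
  split_ne_zero : ∀ k : Fin d, φ k ≠ 0

end THSystem

section TransitionMatrix

variable {K : Type*} [Field K] {d : ℕ}

/-- `τ_h = (λ - θ_0)(λ - θ_1) ⋯ (λ - θ_{h-1})`. -/
noncomputable def tauPoly (θ : Fin (d + 1) → K) (h : ℕ) : K[X] :=
  ∏ k : Fin (d + 1) with k.val < h, (X - C (θ k))

/-- `η_h = (λ - θ_d)(λ - θ_{d-1}) ⋯ (λ - θ_{d-h+1})`. -/
noncomputable def etaPoly (θ : Fin (d + 1) → K) (h : ℕ) : K[X] :=
  ∏ k : Fin (d + 1) with k.val < h, (X - C (θ k.rev))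

/-- The value at `(x, y)` of the two-variable polynomial
`p(λ, μ) = ∑_{h=0}^{d} η_h(λ) τ*_h(μ) / (φ_1 φ_2 ⋯ φ_h)`. -/
noncomputable def twoVariableValue (θ θs : Fin (d + 1) → K) (φ : Fin d → K) (x y : K) : K :=
  ∑ h ∈ Finset.range (d + 1),
    (etaPoly θ h).eval x * (tauPoly θs h).eval y / ∏ k : Fin d with k.val < h, φ k

/-- The west-south normalized transition matrix, with `(i, j)`-entry `p(θ_i, θ*_j)`, attached to a
parameter array. -/
noncomputable def westSouthMatrix (θ θs : Fin (d + 1) → K) (φ : Fin d → K) :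
    Matrix (Fin (d + 1)) (Fin (d + 1)) K :=
  Matrix.of fun i j => twoVariableValue θ θs φ (θ i) (θs j)

end TransitionMatrix

section Vandermonde

variable {K : Type*} [Field K] {d : ℕ}

/-- A graded sequence of polynomials: `f_0 = 1` and `f_i` has degree `i`. -/
def IsGradedSequence (f : Fin (d + 1) → K[X]) : Prop :=
  f 0 = 1 ∧ ∀ i, (f i).degree = ((i : ℕ) : WithBot ℕ)

/-- `X_{ij} = X_{i0} f_j(θ_i)` for some graded sequence `f`, with `θ_0, …, θ_d` mutually
distinct. -/
def VandermondeCompatible (X : Matrix (Fin (d + 1)) (Fin (d + 1)) K) (θ : Fin (d + 1) → K) :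
    Prop :=
  Function.Injective θ ∧
    ∃ f : Fin (d + 1) → K[X], IsGradedSequence f ∧ ∀ i j, X i j = X i 0 * (f j).eval (θ i)

/-- West Vandermonde matrices. -/
def IsWestVandermonde (X : Matrix (Fin (d + 1)) (Fin (d + 1)) K) : Prop :=
  (∃ θ : Fin (d + 1) → K, VandermondeCompatible X θ) ∧ ∀ i, X i 0 ≠ 0

/-- West Vandermonde systems `(X, θ)`. -/
def IsWestVandermondeSystem (X : Matrix (Fin (d + 1)) (Fin (d + 1)) K) (θ : Fin (d + 1) → K) :
    Prop :=
  IsWestVandermonde X ∧ VandermondeCompatible X θ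

/-- The matrix obtained by rotating `X` clockwise by 90 degrees. -/
def rotateClockwise (X : Matrix (Fin (d + 1)) (Fin (d + 1)) K) :
    Matrix (Fin (d + 1)) (Fin (d + 1)) K :=
  Matrix.of fun i j => X j.rev i

/-- South Vandermonde systems `(X, θ)`: rotating `X` clockwise by 90 degrees gives a west
Vandermonde system. -/
def IsSouthVandermondeSystem (X : Matrix (Fin (d + 1)) (Fin (d + 1)) K) (θ : Fin (d + 1) → K) :
    Prop :=
  IsWestVandermondeSystem (rotateClockwise X) θ

theorem VandermondeCompatible.affine {X : Matrix (Fin (d + 1)) (Fin (d + 1)) K}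
    {θ : Fin (d + 1) → K} (h : VandermondeCompatible X θ) {α : K} (hα : α ≠ 0) (β : K) :
    VandermondeCompatible X (fun i => α * θ i + β) := by
  obtain ⟨hinj, f, ⟨hf0, hfd⟩, hX⟩ := h
  have hlin : (C α⁻¹ * (Polynomial.X - C β) : K[X]).natDegree = 1 := by
    rw [natDegree_C_mul (inv_ne_zero hα), natDegree_X_sub_C]
  refine ⟨fun i j hij => hinj (mul_left_cancel₀ hα (add_right_cancel hij)),
    fun i => (f i).comp (C α⁻¹ * (Polynomial.X - C β)), ⟨?_, ?_⟩, ?_⟩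
  · simp [hf0]
  · intro i
    have hne : f i ≠ 0 := by
      intro h0
      have := hfd i
      simp [h0] at this
    have hne' : (f i).comp (C α⁻¹ * (Polynomial.X - C β)) ≠ 0 := by
      rw [Ne, comp_eq_zero_iff]
      rintro (h0 | ⟨-, h0⟩)
      · exact hne h0
      · rw [h0, natDegree_C] at hlin
        exact absurd hlin (by norm_num)
    rw [degree_eq_natDegree hne', natDegree_comp, hlin, mul_one,
      natDegree_eq_of_degree_eq_some (hfd i)]
  · intro i j
    rw [hX i j, eval_comp]
    congr 2
    simp only [eval_mul, eval_C, eval_sub, eval_X]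
    field_simp
    ring

theorem IsWestVandermondeSystem.affine {X : Matrix (Fin (d + 1)) (Fin (d + 1)) K}
    {θ : Fin (d + 1) → K} (h : IsWestVandermondeSystem X θ) {α : K} (hα : α ≠ 0) (β : K) :
    IsWestVandermondeSystem X (fun i => α * θ i + β) :=
  ⟨h.1, h.2.affine hα β⟩

end Vandermonde

/-- A normalized west-south Vandermonde system `(X, θ, θ*)` in `Mat_{d+1}(K)`: every entry in the
leftmost column and in the bottom row of `X` is `1`. -/
@[ext]
structure NormalizedWSVSystem (K : Type u) [Field K] (d : ℕ) where
  X : Matrix (Fin (d + 1)) (Fin (d + 1)) K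
  θ : Fin (d + 1) → K
  θs : Fin (d + 1) → K
  west : IsWestVandermondeSystem X θ
  south : IsSouthVandermondeSystem X θs
  west_normalized : ∀ i, X i 0 = 1
  south_normalized : ∀ i, X (Fin.last d) i = 1

namespace NormalizedWSVSystem

variable {K : Type u} [Field K] {d : ℕ}

/-- The affine transformation `(X, αθ + β, α*θ* + β*)`. -/
def affine (Ω : NormalizedWSVSystem K d) (α β αs βs : K) (hα : α ≠ 0) (hαs : αs ≠ 0) :
    NormalizedWSVSystem K d where
  X := Ω.X
  θ := fun i => α * Ω.θ i + β
  θs := fun i => αs * Ω.θs i + βs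
  west := Ω.west.affine hα β
  south := IsWestVandermondeSystem.affine Ω.south hαs βs
  west_normalized := Ω.west_normalized
  south_normalized := Ω.south_normalized

/-- `Ω` and `Ω'` are affine related: `Ω` is an affine transformation of `Ω'`. -/
def AffineRelated (Ω Ω' : NormalizedWSVSystem K d) : Prop :=
  ∃ (α β αs βs : K) (hα : α ≠ 0) (hαs : αs ≠ 0), Ω = Ω'.affine α β αs βs hα hαs

/-- The affine relation as an equivalence relation. -/
def affineSetoid (K : Type u) [Field K] (d : ℕ) : Setoid (NormalizedWSVSystem K d) where
  r := AffineRelated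
  iseqv := by
    refine ⟨fun Ω => ⟨1, 0, 1, 0, one_ne_zero, one_ne_zero, ?_⟩, ?_, ?_⟩
    · ext <;> simp [affine]
    · rintro Ω Ω' ⟨α, β, αs, βs, hα, hαs, rfl⟩
      refine ⟨α⁻¹, -(α⁻¹ * β), αs⁻¹, -(αs⁻¹ * βs), inv_ne_zero hα, inv_ne_zero hαs, ?_⟩
      ext <;> simp [affine, mul_add, inv_mul_cancel_left₀ hα, inv_mul_cancel_left₀ hαs]
    · rintro Ω Ω' Ω'' ⟨α, β, αs, βs, hα, hαs, rfl⟩ ⟨α', β', αs', βs', hα', hαs', rfl⟩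
      refine ⟨α * α', α * β' + β, αs * αs', αs * βs' + βs, mul_ne_zero hα hα',
        mul_ne_zero hαs hαs', ?_⟩
      ext <;> simp only [affine] <;> ring

/-- The set of affine classes of normalized west-south Vandermonde systems in `Mat_{d+1}(K)`. -/
def AffineClass (K : Type u) [Field K] (d : ℕ) : Type u := Quotient (affineSetoid K d)

/-- The affine class of a normalized west-south Vandermonde system. -/
def affineClass (Ω : NormalizedWSVSystem K d) : AffineClass K d :=
  Quotient.mk (affineSetoid K d) Ω

end NormalizedWSVSystem

/-- The graph of `ρ`: `Ω = (𝒫, θ, θ*)`, where `θ` and `θ*` are the eigenvalue sequence and the dual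
eigenvalue sequence of `Φ`, and `𝒫` is the west-south normalized transition matrix of `Φ`. -/
def IsRhoImage {K : Type u} [Field K] {d : ℕ} (Φ : THSystem K d)
    (Ω : NormalizedWSVSystem K d) : Prop :=
  ∃ φ : Fin d → K, Φ.IsParameterArray Ω.θ Ω.θs φ ∧ Ω.X = westSouthMatrix Ω.θ Ω.θs φ

/-! The split sequence can be bypassed. Choose eigenbases `b` of A and `c` of A*. The transition
matrix from `b` to `c` is determined up to rescaling rows and columns, and putting 1s in the left
column and the bottom row leaves only a common scalar on the two bases, which does not change the
matrix. So a TH system has at most one normalized transition matrix (`IsTransition.unique`), and a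
system is recovered up to isomorphism from this matrix and the two eigenvalue sequences
(`IsTransition.isomorphic`).

The link with 𝒫 is the split basis u_h = η_h(A) c_0 (`exists_isSplitBasis`). It is triangular with
respect to `c` because A is Hessenberg there, and, read backwards, triangular with respect to `b`
because η_h kills the last h eigenvectors of A. Hence U_i is the line of u_i, A is lower bidiagonal
and A* upper bidiagonal in this basis, with the φ_i above the diagonal of A*. Solving the bidiagonal
recursion gives the eigenvectors of A*; since u_h has `b`-coordinates η_h(θ_i) times those of c_0,
their coordinates are the columns of 𝒫, up to scaling `b` by the coordinates of c_0. Thus 𝒫 is the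
normalized transition matrix (`exists_isRhoImage_isTransition`). As both descriptions are
single-valued, they agree (`isRhoImage_iff_isTransition`).

For surjectivity (`exists_isTransition`), take A = diag(θ), with the columns of X as eigenvectors of
A* for θ*. The west polynomials make A Hessenberg on the columns of X; the south polynomials do the
same for A* on the standard basis. Affine changes act on the eigenvalues only and keep the
eigenbases, which settles the statement about affine classes. -/

/-! ### Triangular families and flags -/

section TriangularFamily

variable {K V : Type*} [Field K] [AddCommGroup V] [Module K V] {n : ℕ}

/-- `u` is triangular with respect to `b`: `u j` is a combination of `b 0, …, b j` in which the
coefficient of `b j` is nonzero. -/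
structure IsTriangularFamily (b : Module.Basis (Fin n) K V) (u : Fin n → V) : Prop where
  repr_eq_zero : ∀ i j, j < i → b.repr (u j) i = 0
  repr_ne_zero : ∀ i, b.repr (u i) i ≠ 0

namespace IsTriangularFamily

variable {b : Module.Basis (Fin n) K V} {u : Fin n → V}

theorem repr_sum_eq_zero (h : IsTriangularFamily b u) (g : Fin n → K) {k m : Fin n}
    (hg : ∀ i, k < i → g i = 0) (hm : k < m) : b.repr (∑ i, g i • u i) m = 0 := by
  simp only [map_sum, map_smul, Finsupp.coe_finsetSum, Finset.sum_apply, Finsupp.smul_apply,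
    smul_eq_mul]
  refine Finset.sum_eq_zero fun i _ => ?_
  rcases lt_or_ge k i with hi | hi
  · rw [hg i hi, zero_mul]
  · rw [h.repr_eq_zero m i (hi.trans_lt hm), mul_zero]

theorem repr_sum (h : IsTriangularFamily b u) (g : Fin n → K) {k : Fin n}
    (hg : ∀ i, k < i → g i = 0) :
    b.repr (∑ i, g i • u i) k = g k * b.repr (u k) k := by
  simp only [map_sum, map_smul, Finsupp.coe_finsetSum, Finset.sum_apply, Finsupp.smul_apply,
    smul_eq_mul]
  refine Finset.sum_eq_single k (fun i _ hik => ?_) (by simp)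
  rcases lt_or_gt_of_ne hik with hi | hi
  · rw [h.repr_eq_zero k i hi, mul_zero]
  · rw [hg i hi, zero_mul]

/-- Downward induction: once the coefficients above k vanish, the k-th coordinate of the sum is g k
times a nonzero diagonal entry. The predicate `p` is an upper set of indices, so one statement
serves both linear independence and comparison of flags. -/
theorem coeff_eq_zero (h : IsTriangularFamily b u) (g : Fin n → K) (p : Fin n → Prop)
    (hp : ∀ i j, i ≤ j → p i → p j) (hg : ∀ k, p k → b.repr (∑ i, g i • u i) k = 0) :
    ∀ k, p k → g k = 0 := by
  intro k
  induction k using WellFoundedGT.induction with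
  | ind k ih =>
    intro hk
    have h1 := hg k hk
    rw [h.repr_sum g fun i hi => ih i hi (hp k i hi.le hk)] at h1
    exact (mul_eq_zero.1 h1).resolve_right (h.repr_ne_zero k)

theorem linearIndependent (h : IsTriangularFamily b u) : LinearIndependent K u := by
  rw [Fintype.linearIndependent_iff]
  intro g hg i
  exact h.coeff_eq_zero g (fun _ => True) (fun _ _ _ _ => trivial) (by simp [hg]) i trivial

theorem exists_basis (h : IsTriangularFamily b u) :
    ∃ b' : Module.Basis (Fin n) K V, ∀ i, b' i = u i := by
  rcases isEmpty_or_nonempty (Fin n) with h0 | h0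
  · exact ⟨b, fun i => h0.elim i⟩
  · have hcard : Fintype.card (Fin n) = Module.finrank K V :=
      (Module.finrank_eq_card_basis b).symm
    exact ⟨basisOfLinearIndependentOfCardEqFinrank h.linearIndependent hcard, fun i => by simp⟩

/-- Mutually triangular bases define the same flag of initial spans. -/
theorem repr_eq_zero_iff {b' : Module.Basis (Fin n) K V} (h : IsTriangularFamily b b') (x : V)
    (k : Fin n) : (∀ i, k < i → b.repr x i = 0) ↔ ∀ i, k < i → b'.repr x i = 0 := by
  have hx := b'.sum_repr x
  constructor
  · intro h1
    exact h.coeff_eq_zero _ (fun i => k < i) (fun i j hij hi => hi.trans_le hij)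
      (by rwa [hx])
  · intro h1 i hi
    rw [← hx]
    exact h.repr_sum_eq_zero _ h1 hi

end IsTriangularFamily

theorem Module.Basis.repr_map_eq_sum (b b' : Module.Basis (Fin n) K V) (T : Module.End K V) (x : V)
    (i : Fin n) : b'.repr (T x) i = ∑ k, b.repr x k * b'.repr (T (b k)) i := by
  conv_lhs => rw [← b.sum_repr x]
  simp only [map_sum, map_smul, Finsupp.coe_finsetSum, Finset.sum_apply, Finsupp.smul_apply,
    smul_eq_mul]

end TriangularFamily

/-! ### Eigenbases as coordinates for multiplicity-free maps -/

section Eigenbasis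

variable {K V : Type*} [Field K] [AddCommGroup V] [Module K V] {d : ℕ}

/-- `b` is a basis of eigenvectors of `A` with eigenvalues `θ i`, and `E i` is the projection onto
the line spanned by `b i` along the other basis vectors. -/
structure IsEigenbasis (A : Module.End K V) (θ : Fin (d + 1) → K)
    (E : Fin (d + 1) → Module.End K V) (b : Module.Basis (Fin (d + 1)) K V) : Prop where
  apply_basis : ∀ i, A (b i) = θ i • b i
  proj : ∀ i x, E i x = b.repr x i • b i

/-- Eigenvectors for d + 1 distinct eigenvalues are independent, hence a basis in dimension d + 1.
-/
theorem IsPrimitiveIdempotentOrdering.exists_eigenbasis {A : Module.End K V}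
    {θ : Fin (d + 1) → K} {E : Fin (d + 1) → Module.End K V}
    (h : IsPrimitiveIdempotentOrdering A θ E) (hV : Module.finrank K V = d + 1) :
    ∃ b : Module.Basis (Fin (d + 1)) K V, IsEigenbasis A θ E b := by
  have h1 : ∀ i, ∃ v, A.HasEigenvector (θ i) v := fun i =>
    ((h.hasEigenvalue_iff _).2 ⟨i, rfl⟩).exists_hasEigenvector
  choose v hv using h1
  have hli := Module.End.eigenvectors_linearIndependent' A θ h.injective v hv
  let b := basisOfLinearIndependentOfCardEqFinrank hli (by simp [hV])
  have hb : ∀ i, b i = v i := fun i => by simp [b]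
  refine ⟨b, fun i => ?_, fun i x => ?_⟩
  · rw [hb, (hv i).apply_eq_smul]
  · conv_lhs => rw [← b.sum_repr x]
    rw [map_sum, Finset.sum_eq_single i, map_smul, hb, h.apply_self i _ (hv i).1]
    · intro j _ hji
      rw [map_smul, hb, h.apply_ne i j hji _ (hv j).1, smul_zero]
    · simp

namespace IsEigenbasis

variable {A : Module.End K V} {θ : Fin (d + 1) → K} {E : Fin (d + 1) → Module.End K V}
  {b : Module.Basis (Fin (d + 1)) K V}

theorem repr_apply (h : IsEigenbasis A θ E b) (x : V) (i : Fin (d + 1)) :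
    b.repr (A x) i = θ i * b.repr x i := by
  rw [b.repr_map_eq_sum b, Finset.sum_eq_single i]
  · simp [h.apply_basis, mul_comm]
  · intro k _ hk
    simp [h.apply_basis, hk]
  · simp

theorem repr_aeval (h : IsEigenbasis A θ E b) (p : K[X]) (x : V) (i : Fin (d + 1)) :
    b.repr (aeval A p x) i = p.eval (θ i) * b.repr x i := by
  induction p using Polynomial.induction_on' with
  | add p q hp hq => simp [hp, hq, add_mul]
  | monomial n a =>
    have hpow : b.repr ((A ^ n) x) i = θ i ^ n * b.repr x i := by
      induction n with
      | zero => simp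
      | succ n ih => rw [pow_succ', Module.End.mul_apply, h.repr_apply, ih]; ring
    simp [aeval_monomial, Module.algebraMap_end_eq_smul_id, hpow, mul_assoc]

theorem mem_eigenspace_iff (h : IsEigenbasis A θ E b) {μ : K} {x : V} :
    x ∈ A.eigenspace μ ↔ ∀ i, θ i ≠ μ → b.repr x i = 0 := by
  rw [Module.End.mem_eigenspace_iff, b.ext_elem_iff]
  refine forall_congr' fun i => ?_
  rw [h.repr_apply, map_smul, Finsupp.smul_apply, smul_eq_mul, ← sub_eq_zero, ← sub_mul,
    mul_eq_zero, sub_eq_zero, or_iff_not_imp_left]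

theorem basis_mem_eigenspace (h : IsEigenbasis A θ E b) (i : Fin (d + 1)) :
    b i ∈ A.eigenspace (θ i) :=
  Module.End.mem_eigenspace_iff.2 (h.apply_basis i)

theorem hasEigenvalue_iff (h : IsEigenbasis A θ E b) (μ : K) :
    A.HasEigenvalue μ ↔ ∃ i, θ i = μ := by
  constructor
  · intro hμ
    obtain ⟨v, hv, hv0⟩ := hμ.exists_hasEigenvector
    by_contra! hne
    exact hv0 (b.ext_elem fun i => by simpa using h.mem_eigenspace_iff.1 hv i (hne i))
  · rintro ⟨i, rfl⟩
    exact Module.End.hasEigenvalue_of_hasEigenvector ⟨h.basis_mem_eigenspace i, b.ne_zero i⟩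

theorem eq_smul_of_mem_eigenspace (h : IsEigenbasis A θ E b) (hθ : Function.Injective θ)
    {i : Fin (d + 1)} {x : V} (hx : x ∈ A.eigenspace (θ i)) : x = b.repr x i • b i := by
  refine b.ext_elem fun j => ?_
  rcases eq_or_ne j i with rfl | hj
  · simp
  · rw [h.mem_eigenspace_iff.1 hx j (hθ.ne hj)]
    simp [hj.symm]

theorem isMultiplicityFree (h : IsEigenbasis A θ E b) (hθ : Function.Injective θ) :
    IsMultiplicityFree A := by
  constructor
  · rw [eq_top_iff, ← b.span_eq, Submodule.span_le]
    rintro _ ⟨i, rfl⟩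
    exact le_iSup (fun μ => A.eigenspace μ) (θ i) (h.basis_mem_eigenspace i)
  · intro μ hμ
    obtain ⟨i, rfl⟩ := (h.hasEigenvalue_iff μ).1 hμ
    refine finrank_eq_one_iff'.2 ⟨⟨b i, h.basis_mem_eigenspace i⟩, ?_, fun w => ?_⟩
    · simpa [Subtype.ext_iff] using b.ne_zero i
    · exact ⟨b.repr w i, Subtype.ext (h.eq_smul_of_mem_eigenspace hθ w.2).symm⟩

theorem isPrimitiveIdempotentOrdering (h : IsEigenbasis A θ E b) (hθ : Function.Injective θ) :
    IsPrimitiveIdempotentOrdering A θ E where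
  injective := hθ
  hasEigenvalue_iff := h.hasEigenvalue_iff
  apply_self := fun i v hv => by rw [h.proj, ← h.eq_smul_of_mem_eigenspace hθ hv]
  apply_ne := fun i j hji v hv => by
    rw [h.proj, h.mem_eigenspace_iff.1 hv i (hθ.ne hji.symm), zero_smul]

/-- E_i B E_j carries only the (i, j) matrix entry of B, so the Hessenberg condition on idempotents
becomes one on matrix entries. -/
theorem mul_mul_eq_zero_iff (h : IsEigenbasis A θ E b) (B : Module.End K V) (i j : Fin (d + 1)) :
    E i * B * E j = 0 ↔ b.repr (B (b j)) i = 0 := by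
  constructor
  · intro h0
    have h1 := LinearMap.congr_fun h0 (b j)
    simpa [Module.End.mul_apply, h.proj, b.ne_zero i] using h1
  · intro h0
    ext x
    simp [Module.End.mul_apply, h.proj, h0]

theorem hessenbergCondition_iff (h : IsEigenbasis A θ E b) (B : Module.End K V) :
    HessenbergCondition E B ↔ ∀ i j : Fin (d + 1),
      ((j : ℕ) + 1 < (i : ℕ) → b.repr (B (b j)) i = 0) ∧
      ((i : ℕ) = (j : ℕ) + 1 → b.repr (B (b j)) i ≠ 0) := by
  simp only [HessenbergCondition, ne_eq, h.mul_mul_eq_zero_iff]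

theorem isUnitSMul (h : IsEigenbasis A θ E b) {w : Fin (d + 1) → K} (hw : ∀ i, IsUnit (w i)) :
    IsEigenbasis A θ E (b.isUnitSMul hw) where
  apply_basis := fun i => by
    rw [Module.Basis.isUnitSMul_apply, map_smul, h.apply_basis, smul_comm]
  proj := fun i x => by
    rw [Module.Basis.isUnitSMul_apply, h.proj, Module.Basis.repr_isUnitSMul, smul_smul,
      Units.smul_def, smul_eq_mul, mul_right_comm]
    simp [(hw i).ne_zero]

theorem mem_iSup_range_iff (h : IsEigenbasis A θ E b) (i : Fin (d + 1)) (x : V) :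
    x ∈ (⨆ k : Fin (d + 1), ⨆ _ : k ≤ i, LinearMap.range (E k)) ↔
      ∀ m, i < m → b.repr x m = 0 := by
  constructor
  · intro hx m hm
    have hle : (⨆ k : Fin (d + 1), ⨆ _ : k ≤ i, LinearMap.range (E k)) ≤
        LinearMap.ker (b.coord m) := by
      refine iSup₂_le fun k hk => ?_
      rintro _ ⟨y, rfl⟩
      simp [h.proj, (hk.trans_lt hm).ne]
    simpa using hle hx
  · intro hx
    rw [← b.sum_repr x]
    refine Submodule.sum_mem _ fun k _ => ?_
    rcases lt_or_ge i k with hk | hk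
    · simp [hx k hk]
    · exact Submodule.mem_iSup_of_mem k (Submodule.mem_iSup_of_mem hk ⟨x, h.proj k x⟩)

theorem affine (h : IsEigenbasis A θ E b) (α β : K) :
    IsEigenbasis (α • A + β • (1 : Module.End K V)) (fun i => α * θ i + β) E b where
  apply_basis := fun i => by
    simp [h.apply_basis, add_smul, mul_smul]
  proj := h.proj

theorem map {W : Type*} [AddCommGroup W] [Module K W] (h : IsEigenbasis A θ E b) (f : V ≃ₗ[K] W) :
    IsEigenbasis (f.conjAlgEquiv K A) θ (fun i => f.conjAlgEquiv K (E i)) (b.map f) where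
  apply_basis := fun i => by simp [LinearEquiv.conjAlgEquiv_apply, h.apply_basis]
  proj := fun i x => by simp [LinearEquiv.conjAlgEquiv_apply, h.proj]

theorem conjAlgEquiv_eq {W : Type*} [AddCommGroup W] [Module K W] {A' : Module.End K W}
    {E' : Fin (d + 1) → Module.End K W} {b' : Module.Basis (Fin (d + 1)) K W}
    (h : IsEigenbasis A θ E b) (h' : IsEigenbasis A' θ E' b') (f : V ≃ₗ[K] W)
    (hf : ∀ i, f (b i) = b' i) :
    f.conjAlgEquiv K A = A' ∧ ∀ i, f.conjAlgEquiv K (E i) = E' i := by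
  have hfs : ∀ i, f.symm (b' i) = b i := fun i => by rw [← hf, f.symm_apply_apply]
  refine ⟨b'.ext fun i => ?_, fun i => b'.ext fun j => ?_⟩
  · simp [LinearEquiv.conjAlgEquiv_apply, hfs, h.apply_basis, h'.apply_basis, hf]
  · rcases eq_or_ne j i with rfl | hji
    · simp [LinearEquiv.conjAlgEquiv_apply, hfs, h.proj, h'.proj, hf]
    · simp [LinearEquiv.conjAlgEquiv_apply, hfs, h.proj, h'.proj, hji]

end IsEigenbasis

/-- E_i fixes a nonzero eigenvector for θ_i and would kill it if that eigenvalue had another index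
in θ'. -/
theorem IsPrimitiveIdempotentOrdering.unique {A : Module.End K V} {θ θ' : Fin (d + 1) → K}
    {E : Fin (d + 1) → Module.End K V} (h : IsPrimitiveIdempotentOrdering A θ E)
    (h' : IsPrimitiveIdempotentOrdering A θ' E) : θ = θ' := by
  funext i
  obtain ⟨v, hv, hv0⟩ := ((h.hasEigenvalue_iff _).2 ⟨i, rfl⟩).exists_hasEigenvector
  obtain ⟨k, hk⟩ := (h'.hasEigenvalue_iff _).1 ((h.hasEigenvalue_iff _).2 ⟨i, rfl⟩)
  by_cases hki : k = i
  · rw [← hk, hki]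
  · rw [← hk] at hv
    have h1 := h'.apply_ne i k hki v hv
    rw [hk] at hv
    exact absurd ((h.apply_self i v hv).symm.trans h1) hv0

end Eigenbasis

/-! ### Newton polynomials and the Vandermonde property of 𝒫 -/

section NewtonPolynomials

variable {K : Type*} [Field K] {d : ℕ}

@[simp]
theorem tauPoly_zero (θ : Fin (d + 1) → K) : tauPoly θ 0 = 1 := by
  simp [tauPoly]

theorem tauPoly_succ (θ : Fin (d + 1) → K) (k : Fin (d + 1)) :
    tauPoly θ (k + 1) = tauPoly θ k * (X - C (θ k)) := by
  have h : (Finset.univ.filter fun i : Fin (d + 1) => i.val < k + 1) =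
      insert k (Finset.univ.filter fun i : Fin (d + 1) => i.val < k) := by
    ext i
    simp only [Finset.mem_filter, Finset.mem_univ, true_and, Finset.mem_insert, Fin.ext_iff]
    omega
  rw [tauPoly, h, Finset.prod_insert (by simp), mul_comm, tauPoly]

theorem etaPoly_eq_tauPoly_rev (θ : Fin (d + 1) → K) (h : ℕ) :
    etaPoly θ h = tauPoly (fun i => θ i.rev) h :=
  rfl

theorem etaPoly_succ (θ : Fin (d + 1) → K) (k : Fin (d + 1)) :
    etaPoly θ (k + 1) = etaPoly θ k * (X - C (θ k.rev)) :=
  tauPoly_succ _ k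

theorem eval_tauPoly_eq_zero (θ : Fin (d + 1) → K) {j : Fin (d + 1)} {h : ℕ} (hj : j.val < h) :
    (tauPoly θ h).eval (θ j) = 0 := by
  rw [tauPoly, eval_prod]
  exact Finset.prod_eq_zero (Finset.mem_filter.2 ⟨Finset.mem_univ j, hj⟩) (by simp)

theorem eval_tauPoly_ne_zero {θ : Fin (d + 1) → K} (hθ : Function.Injective θ) {j : Fin (d + 1)}
    {h : ℕ} (hj : h ≤ j.val) : (tauPoly θ h).eval (θ j) ≠ 0 := by
  rw [tauPoly, eval_prod, Finset.prod_ne_zero_iff]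
  intro k hk
  have hk' := (Finset.mem_filter.1 hk).2
  simp only [eval_sub, eval_X, eval_C]
  exact sub_ne_zero.2 (hθ.ne (by rintro rfl; omega))

theorem eval_etaPoly_eq_zero (θ : Fin (d + 1) → K) {j : Fin (d + 1)} {h : ℕ}
    (hj : j.rev.val < h) : (etaPoly θ h).eval (θ j) = 0 := by
  have h1 := eval_tauPoly_eq_zero (fun i => θ i.rev) hj
  simpa only [Fin.rev_rev, ← etaPoly_eq_tauPoly_rev] using h1

theorem eval_etaPoly_ne_zero {θ : Fin (d + 1) → K} (hθ : Function.Injective θ) {j : Fin (d + 1)}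
    {h : ℕ} (hj : h ≤ j.rev.val) : (etaPoly θ h).eval (θ j) ≠ 0 := by
  have h1 := eval_tauPoly_ne_zero (θ := fun i => θ i.rev) (hθ.comp Fin.rev_injective) hj
  simpa only [Fin.rev_rev, ← etaPoly_eq_tauPoly_rev] using h1

theorem degree_tauPoly (θ : Fin (d + 1) → K) {h : ℕ} (hh : h ≤ d + 1) :
    (tauPoly θ h).degree = h := by
  induction h with
  | zero => simp
  | succ h ih =>
    rw [tauPoly_succ θ ⟨h, hh⟩, degree_mul, degree_X_sub_C, ih (by omega)]
    rfl

theorem degree_sum_C_mul {a : ℕ → K} {g : ℕ → K[X]} {j d : ℕ} (hjd : j ≤ d)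
    (hg : ∀ h, h ≤ j → (g h).degree = h) (ha : ∀ h, j < h → a h = 0) (haj : a j ≠ 0) :
    (∑ h ∈ Finset.range (d + 1), C (a h) * g h).degree = j := by
  have hsub : ∑ h ∈ Finset.range (d + 1), C (a h) * g h
      = ∑ h ∈ Finset.range (j + 1), C (a h) * g h := by
    refine (Finset.sum_subset (Finset.range_subset_range.2 (by omega)) fun h _ hh => ?_).symm
    rw [ha h (by simpa using hh), C_0, zero_mul]
  have htop : (C (a j) * g j).degree = j := by rw [degree_C_mul haj, hg j le_rfl]
  rw [hsub, Finset.sum_range_succ, degree_add_eq_right_of_degree_lt, htop]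
  rw [htop]
  refine (degree_sum_le _ _).trans_lt ((Finset.sup_lt_iff (WithBot.bot_lt_coe j)).2 fun h hh => ?_)
  have hlt := Finset.mem_range.1 hh
  rcases eq_or_ne (a h) 0 with h0 | h0
  · rw [h0, C_0, zero_mul, degree_zero]
    exact WithBot.bot_lt_coe j
  · rw [degree_C_mul h0, hg h hlt.le]
    exact WithBot.coe_lt_coe.2 hlt

/-- At μ = θ*_j the terms with h > j contain a zero factor and the term h = j does not, so a
polynomial in λ of degree exactly j remains. -/
theorem exists_gradedSequence_twoVariableValue {θ θs : Fin (d + 1) → K}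
    (hθs : Function.Injective θs) {φ : Fin d → K} (hφ : ∀ k, φ k ≠ 0) :
    ∃ f : Fin (d + 1) → K[X], IsGradedSequence f ∧
      ∀ x j, twoVariableValue θ θs φ x (θs j) = (f j).eval x := by
  have hprod : ∀ h : ℕ, ∏ k : Fin d with k.val < h, φ k ≠ 0 := fun h =>
    Finset.prod_ne_zero_iff.2 fun k _ => hφ k
  refine ⟨fun j => ∑ h ∈ Finset.range (d + 1),
    C ((tauPoly θs h).eval (θs j) / ∏ k : Fin d with k.val < h, φ k) * etaPoly θ h,
    ⟨?_, fun j => ?_⟩, fun x j => ?_⟩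
  · refine (Finset.sum_eq_single 0 ?_ ?_).trans ?_
    · intro h _ hh
      rw [eval_tauPoly_eq_zero θs (by simpa using Nat.pos_of_ne_zero hh), zero_div, C_0, zero_mul]
    · simp
    · simp [etaPoly_eq_tauPoly_rev]
  · refine degree_sum_C_mul (Nat.lt_succ_iff.1 j.2) (fun h hh => ?_) (fun h hh => ?_) ?_
    · exact degree_tauPoly _ (by omega)
    · rw [eval_tauPoly_eq_zero θs hh, zero_div]
    · exact div_ne_zero (eval_tauPoly_ne_zero hθs le_rfl) (hprod _)
  · simp only [twoVariableValue, eval_finsetSum, eval_mul, eval_C]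
    exact Finset.sum_congr rfl fun h _ => by ring

/-- Reversing and exchanging the two sequences swaps η with τ*. This symmetry yields the south
properties of 𝒫 from the west ones. -/
theorem twoVariableValue_swap (θ θs : Fin (d + 1) → K) (φ : Fin d → K) (x y : K) :
    twoVariableValue (fun i => θs i.rev) (fun i => θ i.rev) φ y x =
      twoVariableValue θ θs φ x y := by
  refine Finset.sum_congr rfl fun h _ => ?_
  simp only [etaPoly_eq_tauPoly_rev, Fin.rev_rev]
  rw [mul_comm]

theorem twoVariableValue_zero (θ θs : Fin (d + 1) → K) (φ : Fin d → K) (x : K) :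
    twoVariableValue θ θs φ x (θs 0) = 1 := by
  rw [twoVariableValue, Finset.sum_eq_single 0]
  · simp [etaPoly_eq_tauPoly_rev]
  · intro h _ hh
    rw [eval_tauPoly_eq_zero θs (by simpa using Nat.pos_of_ne_zero hh), mul_zero, zero_div]
  · simp

theorem twoVariableValue_last (θ θs : Fin (d + 1) → K) (φ : Fin d → K) (y : K) :
    twoVariableValue θ θs φ (θ (Fin.last d)) y = 1 := by
  have h := twoVariableValue_zero (fun i => θs i.rev) (fun i => θ i.rev) φ y
  rwa [twoVariableValue_swap, Fin.rev_zero] at h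

/-- The normalized west-south Vandermonde system `(𝒫, θ, θ*)` attached to a parameter array. -/
noncomputable def NormalizedWSVSystem.ofParameterArray {K : Type u} [Field K]
    (θ θs : Fin (d + 1) → K) (φ : Fin d → K) (hθ : Function.Injective θ)
    (hθs : Function.Injective θs) (hφ : ∀ k, φ k ≠ 0) : NormalizedWSVSystem K d where
  X := westSouthMatrix θ θs φ
  θ := θ
  θs := θs
  west := by
    have h1 : ∀ i, westSouthMatrix θ θs φ i 0 = 1 := fun i => twoVariableValue_zero θ θs φ _
    have h2 : VandermondeCompatible (westSouthMatrix θ θs φ) θ := by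
      obtain ⟨f, hf, hf'⟩ := exists_gradedSequence_twoVariableValue (θ := θ) hθs hφ
      exact ⟨hθ, f, hf, fun i j => by rw [h1, one_mul, ← hf']; rfl⟩
    exact ⟨⟨⟨θ, h2⟩, fun i => by simp [h1]⟩, h2⟩
  south := by
    have h1 : ∀ i, rotateClockwise (westSouthMatrix θ θs φ) i 0 = 1 := fun i => by
      simpa [rotateClockwise, westSouthMatrix] using twoVariableValue_last θ θs φ _
    have h2 : VandermondeCompatible (rotateClockwise (westSouthMatrix θ θs φ)) θs := by
      obtain ⟨f, hf, hf'⟩ := exists_gradedSequence_twoVariableValue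
        (θ := fun i => θs i.rev) (hθ.comp Fin.rev_injective) hφ
      refine ⟨hθs, f, hf, fun i j => ?_⟩
      rw [h1, one_mul, ← hf']
      exact (twoVariableValue_swap θ θs φ _ _).symm
    exact ⟨⟨⟨θs, h2⟩, fun i => by simp [h1]⟩, h2⟩
  west_normalized := fun _ => twoVariableValue_zero θ θs φ _
  south_normalized := fun _ => twoVariableValue_last θ θs φ _

end NewtonPolynomials

/-! ### The split basis and the eigenvectors of A* -/

section SplitBasis

variable {K V : Type*} [Field K] [AddCommGroup V] [Module K V] {d : ℕ}

/-- `T` has upper Hessenberg shape with nonzero subdiagonal with respect to the basis `b`. -/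
def IsHessenbergOn (b : Module.Basis (Fin (d + 1)) K V) (T : Module.End K V) : Prop :=
  ∀ i j : Fin (d + 1), ((j : ℕ) + 1 < (i : ℕ) → b.repr (T (b j)) i = 0) ∧
    ((i : ℕ) = (j : ℕ) + 1 → b.repr (T (b j)) i ≠ 0)

namespace IsHessenbergOn

variable {b : Module.Basis (Fin (d + 1)) K V} {T : Module.End K V}

theorem repr_apply_eq_zero (h : IsHessenbergOn b T) {x : V} {k i : Fin (d + 1)}
    (hx : ∀ m, k < m → b.repr x m = 0) (hi : (k : ℕ) + 1 < i) : b.repr (T x) i = 0 := by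
  rw [b.repr_map_eq_sum b]
  refine Finset.sum_eq_zero fun m _ => ?_
  rcases lt_or_ge k m with hm | hm
  · rw [hx m hm, zero_mul]
  · rw [(h i m).1 (by have := Fin.le_def.1 hm; omega), mul_zero]

theorem repr_apply_ne_zero (h : IsHessenbergOn b T) {x : V} {k i : Fin (d + 1)}
    (hx : ∀ m, k < m → b.repr x m = 0) (hk : b.repr x k ≠ 0) (hi : (i : ℕ) = k + 1) :
    b.repr (T x) i ≠ 0 := by
  rw [b.repr_map_eq_sum b, Finset.sum_eq_single k]
  · exact mul_ne_zero hk ((h i k).2 hi)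
  · intro m _ hmk
    rcases lt_or_gt_of_ne hmk with hm | hm
    · rw [(h i m).1 (by have := Fin.lt_def.1 hm; omega), mul_zero]
    · rw [hx m hm, zero_mul]
  · simp

/-- Each further factor T - θ of η_j(T) raises the top index by exactly one, because the subdiagonal
of T is nonzero. -/
theorem isTriangularFamily (h : IsHessenbergOn b T) (θ : Fin (d + 1) → K) :
    IsTriangularFamily b fun j => aeval T (etaPoly θ j) (b 0) := by
  have key : ∀ j : Fin (d + 1), (∀ i, j < i → b.repr (aeval T (etaPoly θ j) (b 0)) i = 0) ∧
      b.repr (aeval T (etaPoly θ j) (b 0)) j ≠ 0 := by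
    intro j
    induction j using Fin.induction with
    | zero => simp +contextual [etaPoly_eq_tauPoly_rev, Fin.ne_of_lt]
    | succ k ih =>
      have hu : aeval T (etaPoly θ k.succ) (b 0) =
          T (aeval T (etaPoly θ k.castSucc) (b 0)) -
            θ k.castSucc.rev • aeval T (etaPoly θ k.castSucc) (b 0) := by
        have := etaPoly_succ θ k.castSucc
        rw [Fin.val_castSucc] at this
        rw [Fin.val_succ, this, mul_comm, map_mul, Module.End.mul_apply]
        simp [Module.algebraMap_end_eq_smul_id]
      rw [hu]
      have hs : ∀ i, k.succ ≤ i → k.castSucc < i := fun i hi =>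
        (Fin.castSucc_lt_succ (i := k)).trans_le hi
      refine ⟨fun i hi => ?_, ?_⟩
      · rw [map_sub, Finsupp.sub_apply, map_smul, Finsupp.smul_apply, ih.1 i (hs i hi.le),
          smul_zero, sub_zero]
        exact h.repr_apply_eq_zero ih.1 (by simpa using Fin.lt_def.1 hi)
      · rw [map_sub, Finsupp.sub_apply, map_smul, Finsupp.smul_apply, ih.1 _ (hs _ le_rfl),
          smul_zero, sub_zero]
        exact h.repr_apply_ne_zero ih.1 ih.2 (by simp)
  exact ⟨fun i j => (key j).1 i, fun i => (key i).2⟩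

end IsHessenbergOn

/-- The split basis `u h = η_h(A) c 0` attached to eigenbases `b` of `A` and `c` of `As`. -/
structure IsSplitBasis (A As : Module.End K V) (θ θs : Fin (d + 1) → K)
    (b c : Module.Basis (Fin (d + 1)) K V) (φ : Fin d → K)
    (u : Module.Basis (Fin (d + 1)) K V) : Prop where
  eq_aeval : ∀ j : Fin (d + 1), u j = aeval A (etaPoly θ j) (c 0)
  repr_ne_zero : ∀ i, b.repr (c 0) i ≠ 0
  split_ne_zero : ∀ k, φ k ≠ 0
  apply_succ : ∀ k : Fin d, As (u k.succ) = θs k.succ • u k.succ + φ k • u k.castSucc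
  flag_inter : ∀ i x, ((∀ m, i < m → c.repr x m = 0) ∧ ∀ m, i.rev < m → b.repr x m = 0) ↔
    x = u.repr x i • u i

theorem exists_isSplitBasis {A As : Module.End K V} {θ θs : Fin (d + 1) → K}
    {E Es : Fin (d + 1) → Module.End K V} {b c : Module.Basis (Fin (d + 1)) K V}
    (hb : IsEigenbasis A θ E b) (hc : IsEigenbasis As θs Es c) (hθ : Function.Injective θ)
    (hbs : IsHessenbergOn b As) (hcA : IsHessenbergOn c A) :
    ∃ φ u, IsSplitBasis A As θ θs b c φ u := by
  have htri := hcA.isTriangularFamily θ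
  obtain ⟨u, hu⟩ := htri.exists_basis
  have hcu : IsTriangularFamily c u := by rwa [← funext hu] at htri
  have hbu : ∀ j i, b.repr (u j) i = (etaPoly θ j).eval (θ i) * b.repr (c 0) i := fun j i => by
    rw [hu, hb.repr_aeval]
  -- If c_0 had zero i-th coordinate, so would every polynomial in A applied to it, hence the whole
  -- basis `u`.
  have hne : ∀ i, b.repr (c 0) i ≠ 0 := by
    intro i h0
    have h1 : b.coord i = 0 := u.ext fun j => by simp [hbu, h0]
    simpa using LinearMap.congr_fun h1 (b i)
  -- η_j vanishes at the last j eigenvalues, so u_j lies in the span of b_0, …, b_{d-j} and has a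
  -- nonzero top coordinate there.
  have hbr : IsTriangularFamily b (u.reindex Fin.revPerm) := by
    refine ⟨fun i j hij => ?_, fun i => ?_⟩
    · rw [Module.Basis.reindex_apply, hbu]
      simp only [Fin.revPerm_symm, Fin.revPerm_apply]
      rw [eval_etaPoly_eq_zero θ (Fin.rev_lt_rev.2 hij), zero_mul]
    · rw [Module.Basis.reindex_apply, hbu]
      exact mul_ne_zero (eval_etaPoly_ne_zero hθ le_rfl) (hne i)
  have hflag : ∀ i x, ((∀ m, i < m → c.repr x m = 0) ∧ ∀ m, i.rev < m → b.repr x m = 0) ↔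
      x = u.repr x i • u i := by
    intro i x
    rw [hcu.repr_eq_zero_iff, hbr.repr_eq_zero_iff]
    simp only [Module.Basis.repr_reindex_apply, Fin.revPerm_symm, Fin.revPerm_apply]
    constructor
    · rintro ⟨h1, h2⟩
      refine u.ext_elem fun m => ?_
      rcases lt_trichotomy m i with hm | rfl | hm
      · have := h2 m.rev (Fin.rev_lt_rev.2 hm)
        rw [Fin.rev_rev] at this
        simp [this, hm.ne']
      · simp
      · simp [h1 m hm, hm.ne]
    · intro h
      have h0 : ∀ m, m ≠ i → u.repr x m = 0 := fun m hm => by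
        rw [h]
        simp [hm.symm]
      refine ⟨fun m hm => h0 m hm.ne', fun m hm => h0 _ ?_⟩
      rintro rfl
      simp at hm
  -- y k lies on the line of u_k: A* - θ*_{k+1} is diagonal on `c` and removes the top coordinate k
  -- + 1 of u_{k+1}, while in the `b`-flag A* raises the level by at most one. The coefficient is φ
  -- k.
  let y : Fin d → V := fun k => As (u k.succ) - θs k.succ • u k.succ
  have hbz : ∀ k : Fin d, ∀ m, k.succ.rev < m → b.repr (u k.succ) m = 0 := fun k m hm => by
    rw [hbu, eval_etaPoly_eq_zero θ (Fin.rev_lt_iff.1 hm), zero_mul]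
  have hy : ∀ k, y k = u.repr (y k) k.castSucc • u k.castSucc := by
    intro k
    refine (hflag _ _).1 ⟨fun m hm => ?_, fun m hm => ?_⟩
    · rw [map_sub, Finsupp.sub_apply, hc.repr_apply, map_smul, Finsupp.smul_apply, smul_eq_mul,
        ← sub_mul]
      rcases eq_or_ne m k.succ with rfl | hmk
      · rw [sub_self, zero_mul]
      · rw [hcu.repr_eq_zero m k.succ, mul_zero]
        exact lt_of_le_of_ne (Fin.castSucc_lt_iff_succ_le.1 hm) hmk.symm
    · have hm' := Fin.lt_def.1 hm
      simp only [Fin.val_rev, Fin.val_castSucc] at hm'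
      rw [map_sub, Finsupp.sub_apply, hbs.repr_apply_eq_zero (hbz k), map_smul,
        Finsupp.smul_apply, hbz k, smul_zero, sub_zero]
      · rw [Fin.lt_def, Fin.val_rev, Fin.val_succ]; omega
      · rw [Fin.val_rev, Fin.val_succ]; omega
  refine ⟨fun k => u.repr (y k) k.castSucc, u, hu, hne, fun k h0 => ?_, fun k => ?_, hflag⟩
  · have hy0 : b.repr (y k) k.castSucc.rev = 0 := by
      rw [hy k, h0, zero_smul, map_zero, Finsupp.zero_apply]
    have hr : k.succ.rev < k.castSucc.rev := Fin.rev_lt_rev.2 Fin.castSucc_lt_succ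
    rw [map_sub, Finsupp.sub_apply, map_smul, Finsupp.smul_apply, hbz k _ hr, smul_zero,
      sub_zero] at hy0
    refine hbs.repr_apply_ne_zero (hbz k) ?_ ?_ hy0
    · rw [hbu]
      exact mul_ne_zero (eval_etaPoly_ne_zero hθ (by simp)) (hne _)
    · simp only [Fin.val_rev, Fin.val_castSucc, Fin.val_succ]; omega
  · rw [← hy k]
    simp [y]

namespace IsSplitBasis

variable {A As : Module.End K V} {θ θs : Fin (d + 1) → K} {E Es : Fin (d + 1) → Module.End K V}
  {b c u : Module.Basis (Fin (d + 1)) K V} {φ : Fin d → K}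

theorem apply_castSucc (h : IsSplitBasis A As θ θs b c φ u) (k : Fin d) :
    A (u k.castSucc) = θ k.castSucc.rev • u k.castSucc + u k.succ := by
  have hs := etaPoly_succ θ k.castSucc
  rw [Fin.val_castSucc] at hs
  rw [h.eq_aeval k.succ, Fin.val_succ, hs, mul_comm, map_mul, Module.End.mul_apply,
    h.eq_aeval k.castSucc]
  simp [Module.algebraMap_end_eq_smul_id]

theorem star_apply_zero (h : IsSplitBasis A As θ θs b c φ u) (hc : IsEigenbasis As θs Es c) :
    As (u 0) = θs 0 • u 0 := by
  have h0 : u 0 = c 0 := by simp [h.eq_aeval, etaPoly_eq_tauPoly_rev]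
  rw [h0, hc.apply_basis]

/-- The eigenvector `∑ h, τ*_h(θ*_j) / (φ_1 ⋯ φ_h) u_h` of `As` for `θ*_j`. -/
noncomputable def _root_.splitEigenvector (u : Module.Basis (Fin (d + 1)) K V)
    (θs : Fin (d + 1) → K) (φ : Fin d → K) (j : Fin (d + 1)) : V :=
  ∑ h : Fin (d + 1),
    ((tauPoly θs h).eval (θs j) / ∏ k : Fin d with k.val < h.val, φ k) • u h

theorem prod_succ (φ : Fin d → K) (k : Fin d) :
    ∏ i : Fin d with i.val < k.val + 1, φ i = (∏ i : Fin d with i.val < k.val, φ i) * φ k := by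
  have h : (Finset.univ.filter fun i : Fin d => i.val < k + 1) =
      insert k (Finset.univ.filter fun i : Fin d => i.val < k) := by
    ext i
    simp only [Finset.mem_filter, Finset.mem_univ, true_and, Finset.mem_insert, Fin.ext_iff]
    omega
  rw [h, Finset.prod_insert (by simp), mul_comm]

/-- A* is upper bidiagonal in `u`, so the eigenvector equation is a two-term recursion for the
coefficients (`hstep`) together with a boundary condition at h = d (`hlast`). -/
theorem splitEigenvector_mem (h : IsSplitBasis A As θ θs b c φ u)
    (hc : IsEigenbasis As θs Es c) (j : Fin (d + 1)) :
    As (splitEigenvector u θs φ j) = θs j • splitEigenvector u θs φ j := by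
  set a : ℕ → K := fun h => (tauPoly θs h).eval (θs j) / ∏ k : Fin d with k.val < h, φ k with ha
  have hstep : ∀ k : Fin d, a (k + 1) * φ k = a k * (θs j - θs k.castSucc) := by
    intro k
    have h1 := tauPoly_succ θs k.castSucc
    rw [Fin.val_castSucc] at h1
    have h2 : ∏ i : Fin d with i.val < k.val, φ i ≠ 0 :=
      Finset.prod_ne_zero_iff.2 fun i _ => h.split_ne_zero i
    simp only [ha, h1, prod_succ, eval_mul, eval_sub, eval_X, eval_C]
    field_simp [h.split_ne_zero k]
  have hlast : a d * (θs (Fin.last d) - θs j) = 0 := by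
    rcases eq_or_ne j (Fin.last d) with rfl | hj
    · rw [sub_self, mul_zero]
    · simp only [ha]
      rw [eval_tauPoly_eq_zero θs (Fin.val_lt_last hj), zero_div, zero_mul]
  have hsum : splitEigenvector u θs φ j = ∑ h : Fin (d + 1), a h • u h := rfl
  have h1 : ∑ h : Fin (d + 1), a h • (As (u h) - θs h • u h) =
      ∑ k : Fin d, (a (k + 1) * φ k) • u k.castSucc := by
    rw [Fin.sum_univ_succ, h.star_apply_zero hc, sub_self, smul_zero, zero_add]
    refine Finset.sum_congr rfl fun k _ => ?_
    rw [h.apply_succ, add_sub_cancel_left, smul_smul, Fin.val_succ]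
  have h2 : ∑ h : Fin (d + 1), (a h * (θs h - θs j)) • u h =
      ∑ k : Fin d, (a k * (θs k.castSucc - θs j)) • u k.castSucc := by
    rw [Fin.sum_univ_castSucc, Fin.val_last, hlast, zero_smul, add_zero]
    rfl
  rw [← sub_eq_zero, hsum, map_sum, Finset.smul_sum, ← Finset.sum_sub_distrib]
  calc ∑ h : Fin (d + 1), (As (a h • u h) - θs j • a h • u h)
      = ∑ h : Fin (d + 1), a h • (As (u h) - θs h • u h) +
        ∑ h : Fin (d + 1), (a h * (θs h - θs j)) • u h := by
        rw [← Finset.sum_add_distrib]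
        refine Finset.sum_congr rfl fun h _ => ?_
        rw [map_smul]
        module
    _ = 0 := by
        rw [h1, h2, ← Finset.sum_add_distrib]
        refine Finset.sum_eq_zero fun k _ => ?_
        rw [hstep, ← add_smul]
        ring_nf
        simp

theorem splitEigenvector_ne_zero (u : Module.Basis (Fin (d + 1)) K V) (θs : Fin (d + 1) → K)
    (φ : Fin d → K) (j : Fin (d + 1)) : splitEigenvector u θs φ j ≠ 0 := by
  intro h0
  have h1 : u.repr (splitEigenvector u θs φ j) 0 = 1 := by
    simp [splitEigenvector, Finsupp.single_apply]
  rw [h0] at h1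
  simp at h1

/-- This is where 𝒫 appears: u_h has `b`-coordinates η_h(θ_i) times those of c_0, so the sum over h
is the two-variable polynomial. -/
theorem repr_splitEigenvector (h : IsSplitBasis A As θ θs b c φ u) (hb : IsEigenbasis A θ E b)
    (i j : Fin (d + 1)) :
    b.repr (splitEigenvector u θs φ j) i = westSouthMatrix θ θs φ i j * b.repr (c 0) i := by
  have h1 : ∀ k, b.repr (u k) i = (etaPoly θ k).eval (θ i) * b.repr (c 0) i := fun k => by
    rw [h.eq_aeval, hb.repr_aeval]
  simp only [splitEigenvector, map_sum, map_smul, Finsupp.coe_finsetSum, Finset.sum_apply,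
    Finsupp.smul_apply, smul_eq_mul, h1, westSouthMatrix, Matrix.of_apply, twoVariableValue,
    Finset.sum_mul]
  rw [← Fin.sum_univ_eq_sum_range (fun k => (etaPoly θ k).eval (θ i) *
    (tauPoly θs k).eval (θs j) / (∏ m : Fin d with m.val < k, φ m) * b.repr (c 0) i)]
  exact Finset.sum_congr rfl fun k _ => by ring

end IsSplitBasis

end SplitBasis

/-! ### 𝒫 as the unique normalized transition matrix -/

namespace THSystem

variable {K : Type u} [Field K] {d : ℕ}

/-- `X` is the transition matrix from an eigenbasis of `A` to an eigenbasis of `A*`, where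
`Ω = (X, θ, θ*)` and `θ`, `θ*` are the eigenvalue sequence and the dual eigenvalue sequence. -/
def IsTransition (Φ : THSystem K d) (Ω : NormalizedWSVSystem K d) : Prop :=
  ∃ b c : Module.Basis (Fin (d + 1)) K Φ.V, IsEigenbasis Φ.A Ω.θ Φ.E b ∧
    IsEigenbasis Φ.Astar Ω.θs Φ.Estar c ∧ ∀ j, c j = ∑ i, Ω.X i j • b i

theorem mem_splitSubspace_iff {Φ : THSystem K d} {θ θs : Fin (d + 1) → K} {φ : Fin d → K}
    {b c u : Module.Basis (Fin (d + 1)) K Φ.V} (hb : IsEigenbasis Φ.A θ Φ.E b)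
    (hc : IsEigenbasis Φ.Astar θs Φ.Estar c) (hu : IsSplitBasis Φ.A Φ.Astar θ θs b c φ u)
    (i : Fin (d + 1)) (x : Φ.V) : x ∈ Φ.splitSubspace i ↔ x = u.repr x i • u i := by
  rw [splitSubspace, Submodule.mem_inf, hc.mem_iSup_range_iff, hb.mem_iSup_range_iff,
    hu.flag_inter]

theorem IsParameterArray.of_isSplitBasis {Φ : THSystem K d} {θ θs : Fin (d + 1) → K}
    {φ : Fin d → K} {b c u : Module.Basis (Fin (d + 1)) K Φ.V} (hb : IsEigenbasis Φ.A θ Φ.E b)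
    (hc : IsEigenbasis Φ.Astar θs Φ.Estar c) (hθ : Function.Injective θ)
    (hθs : Function.Injective θs) (hu : IsSplitBasis Φ.A Φ.Astar θ θs b c φ u) :
    Φ.IsParameterArray θ θs φ where
  eigenvalues := hb.isPrimitiveIdempotentOrdering hθ
  dualEigenvalues := hc.isPrimitiveIdempotentOrdering hθs
  split_ne_bot := fun k =>
    (Submodule.ne_bot_iff _).2
      ⟨u k.succ, (mem_splitSubspace_iff hb hc hu _ _).2 (by simp), u.ne_zero _⟩
  split_apply := fun k x hx => by
    rw [(mem_splitSubspace_iff hb hc hu _ _).1 hx]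
    simp only [Module.End.mul_apply, LinearMap.sub_apply, LinearMap.smul_apply,
      Module.End.one_apply, map_smul, map_add, map_sub, hu.apply_succ, hu.apply_castSucc]
    module
  split_ne_zero := hu.split_ne_zero

theorem IsParameterArray.unique {Φ : THSystem K d} {θ θs θ' θs' : Fin (d + 1) → K}
    {φ φ' : Fin d → K} (h : Φ.IsParameterArray θ θs φ) (h' : Φ.IsParameterArray θ' θs' φ') :
    θ = θ' ∧ θs = θs' ∧ φ = φ' := by
  obtain rfl := h.eigenvalues.unique h'.eigenvalues
  obtain rfl := h.dualEigenvalues.unique h'.dualEigenvalues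
  refine ⟨rfl, rfl, funext fun k => ?_⟩
  obtain ⟨x, hx, hx0⟩ := (Submodule.ne_bot_iff _).1 (h.split_ne_bot k)
  exact smul_left_injective K hx0 ((h.split_apply k x hx).symm.trans (h'.split_apply k x hx))

theorem _root_.IsRhoImage.unique {Φ : THSystem K d} {Ω Ω' : NormalizedWSVSystem K d}
    (h : IsRhoImage Φ Ω) (h' : IsRhoImage Φ Ω') : Ω = Ω' := by
  obtain ⟨φ, h1, h2⟩ := h
  obtain ⟨φ', h1', h2'⟩ := h'
  obtain ⟨hθ, hθs, hφ⟩ := h1.unique h1'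
  have hX : Ω.X = Ω'.X := by rw [h2, h2', hθ, hθs, hφ]
  exact NormalizedWSVSystem.ext hX hθ hθs

theorem exists_isRhoImage_isTransition (Φ : THSystem K d) :
    ∃ Ω, IsRhoImage Φ Ω ∧ Φ.IsTransition Ω := by
  obtain ⟨θ, hθ⟩ := Φ.ordering
  obtain ⟨θs, hθs⟩ := Φ.ordering_star
  obtain ⟨b, hb⟩ := hθ.exists_eigenbasis Φ.finrank_eq
  obtain ⟨c, hc⟩ := hθs.exists_eigenbasis Φ.finrank_eq
  obtain ⟨φ, u, hu⟩ := exists_isSplitBasis hb hc hθ.injective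
    ((hb.hessenbergCondition_iff _).1 Φ.hessenberg)
    ((hc.hessenbergCondition_iff _).1 Φ.hessenberg_star)
  refine ⟨.ofParameterArray θ θs φ hθ.injective hθs.injective hu.split_ne_zero,
    ⟨φ, .of_isSplitBasis hb hc hθ.injective hθs.injective hu, rfl⟩, ?_⟩
  have hw : ∀ j, splitEigenvector u θs φ j =
      c.repr (splitEigenvector u θs φ j) j • c j := fun j =>
    hc.eq_smul_of_mem_eigenspace hθs.injective
      (Module.End.mem_eigenspace_iff.2 (hu.splitEigenvector_mem hc j))
  have hw0 : ∀ j, IsUnit (c.repr (splitEigenvector u θs φ j) j) := fun j => by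
    refine isUnit_iff_ne_zero.2 fun h0 => ?_
    have h1 := hw j
    rw [h0, zero_smul] at h1
    exact IsSplitBasis.splitEigenvector_ne_zero u θs φ j h1
  -- Scaling b_i by the i-th coordinate of c_0, and c_j to the split eigenvector, absorbs every
  -- factor except 𝒫.
  refine ⟨b.isUnitSMul fun i => isUnit_iff_ne_zero.2 (hu.repr_ne_zero i), c.isUnitSMul hw0,
    hb.isUnitSMul _, hc.isUnitSMul _, fun j => ?_⟩
  rw [Module.Basis.isUnitSMul_apply, ← hw]
  conv_lhs => rw [← b.sum_repr (splitEigenvector u θs φ j)]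
  refine Finset.sum_congr rfl fun i _ => ?_
  rw [hu.repr_splitEigenvector hb, Module.Basis.isUnitSMul_apply, smul_smul]
  rfl

/-- Eigenbases differ by scalars, so the two matrices differ by row and column scalings. The column
of 1s makes all row scalars equal to one scalar, and the row of 1s makes the column scalars equal to
it too. -/
theorem IsTransition.unique {Φ : THSystem K d} {Ω Ω' : NormalizedWSVSystem K d}
    (h : Φ.IsTransition Ω) (h' : Φ.IsTransition Ω') : Ω = Ω' := by
  obtain ⟨b, c, hb, hc, hX⟩ := h
  obtain ⟨b', c', hb', hc', hX'⟩ := h'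
  have hθ := (hb.isPrimitiveIdempotentOrdering Ω.west.2.1).unique
    (hb'.isPrimitiveIdempotentOrdering Ω'.west.2.1)
  have hθs := (hc.isPrimitiveIdempotentOrdering Ω.south.2.1).unique
    (hc'.isPrimitiveIdempotentOrdering Ω'.south.2.1)
  refine NormalizedWSVSystem.ext ?_ hθ hθs
  have hs : ∀ i, b' i = b.repr (b' i) i • b i := fun i =>
    hb.eq_smul_of_mem_eigenspace Ω.west.2.1 (by rw [hθ]; exact hb'.basis_mem_eigenspace i)
  have ht : ∀ j, c' j = c.repr (c' j) j • c j := fun j =>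
    hc.eq_smul_of_mem_eigenspace Ω.south.2.1 (by rw [hθs]; exact hc'.basis_mem_eigenspace j)
  have key : ∀ i j, Ω'.X i j * b.repr (b' i) i = c.repr (c' j) j * Ω.X i j := by
    intro i j
    have h1 : b.repr (c' j) i = Ω'.X i j * b.repr (b' i) i := by
      rw [hX']
      simp only [map_sum, map_smul, Finsupp.coe_finsetSum, Finset.sum_apply, Finsupp.smul_apply,
        smul_eq_mul]
      refine Finset.sum_eq_single i (fun k _ hk => ?_) (by simp)
      rw [hs k, map_smul, Finsupp.smul_apply, b.repr_self, Finsupp.single_eq_of_ne hk.symm,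
        smul_zero, mul_zero]
    have h2 : b.repr (c j) i = Ω.X i j := by
      rw [hX, b.repr_sum_self]
    rw [← h1, ← h2]
    conv_lhs => rw [ht j]
    simp
  have h0 : ∀ i, b.repr (b' i) i = c.repr (c' 0) 0 := fun i => by
    simpa [Ω.west_normalized, Ω'.west_normalized] using key i 0
  have h1 : ∀ j, c.repr (c' j) j = c.repr (c' 0) 0 := fun j => by
    have := key (Fin.last d) j
    rw [Ω.south_normalized, Ω'.south_normalized, one_mul, mul_one, h0] at this
    exact this.symm
  have hne : c.repr (c' 0) 0 ≠ 0 := fun h => by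
    have h2 := ht 0
    rw [h, zero_smul] at h2
    exact c'.ne_zero 0 h2
  ext i j
  have h3 := key i j
  rw [h0, h1 j, mul_comm] at h3
  exact (mul_left_cancel₀ hne h3).symm

theorem isRhoImage_iff_isTransition {Φ : THSystem K d} {Ω : NormalizedWSVSystem K d} :
    IsRhoImage Φ Ω ↔ Φ.IsTransition Ω := by
  obtain ⟨Ω₀, h1, h2⟩ := Φ.exists_isRhoImage_isTransition
  constructor
  · intro h
    rwa [h.unique h1]
  · intro h
    rwa [h.unique h2]

/-- Every algebra isomorphism End(V) → End(W) is conjugation by a linear isomorphism, which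
transports both eigenbases. -/
theorem IsTransition.of_isomorphic {Φ Ψ : THSystem K d} {Ω : NormalizedWSVSystem K d}
    (h : Φ.IsTransition Ω) (hΦ : Isomorphic Φ Ψ) : Ψ.IsTransition Ω := by
  obtain ⟨b, c, hb, hc, hX⟩ := h
  obtain ⟨γ, h1, h2, h3, h4⟩ := hΦ
  obtain ⟨f, rfl⟩ := γ.eq_linearEquivConjAlgEquiv
  refine ⟨b.map f, c.map f, ?_, ?_, fun j => ?_⟩
  · have := hb.map f
    rwa [h1, funext h3] at this
  · have := hc.map f
    rwa [h2, funext h4] at this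
  · simp [hX]

/-- The linear map sending `b` to `b'` also sends `c` to `c'`, since both are expanded by the same
matrix. -/
theorem IsTransition.isomorphic {Φ Ψ : THSystem K d} {Ω : NormalizedWSVSystem K d}
    (h : Φ.IsTransition Ω) (h' : Ψ.IsTransition Ω) : Isomorphic Φ Ψ := by
  obtain ⟨b, c, hb, hc, hX⟩ := h
  obtain ⟨b', c', hb', hc', hX'⟩ := h'
  have hf : ∀ i, b.equiv b' (Equiv.refl _) (b i) = b' i := fun i => by simp
  have hg : ∀ j, b.equiv b' (Equiv.refl _) (c j) = c' j := fun j => by simp [hX, hX']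
  obtain ⟨h1, h3⟩ := hb.conjAlgEquiv_eq hb' _ hf
  obtain ⟨h2, h4⟩ := hc.conjAlgEquiv_eq hc' _ hg
  exact ⟨_, h1, h2, h3, h4⟩

theorem IsTransition.affine {Φ : THSystem K d} {Ω : NormalizedWSVSystem K d}
    (h : Φ.IsTransition Ω) (α β αs βs : K) (hα : α ≠ 0) (hαs : αs ≠ 0) :
    (Φ.affine α β αs βs hα hαs).IsTransition (Ω.affine α β αs βs hα hαs) := by
  obtain ⟨b, c, hb, hc, hX⟩ := h
  exact ⟨b, c, hb.affine α β, hc.affine αs βs, hX⟩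

end THSystem

/-! ### Constructing a TH system from a Vandermonde system -/

theorem IsGradedSequence.natDegree_eq {K : Type*} [Field K] {d : ℕ} {f : Fin (d + 1) → K[X]}
    (hf : IsGradedSequence f) (j : Fin (d + 1)) : (f j).natDegree = j :=
  natDegree_eq_of_degree_eq_some (hf.2 j)

theorem IsGradedSequence.coeff_ne_zero {K : Type*} [Field K] {d : ℕ} {f : Fin (d + 1) → K[X]}
    (hf : IsGradedSequence f) (j : Fin (d + 1)) : (f j).coeff j ≠ 0 :=
  coeff_ne_zero_of_eq_degree (hf.2 j)

/-- The columns of a Vandermonde matrix form a basis, with respect to which the diagonal matrix of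
nodes has Hessenberg shape. -/
theorem exists_basis_isHessenbergOn {K : Type*} [Field K] {d : ℕ} {θ : Fin (d + 1) → K}
    (hθ : Function.Injective θ) {f : Fin (d + 1) → K[X]} (hf : IsGradedSequence f) :
    ∃ c : Module.Basis (Fin (d + 1)) K (Fin (d + 1) → K),
      (∀ j i, c j i = (f j).eval (θ i)) ∧
      IsHessenbergOn c (Matrix.toLin' (Matrix.diagonal θ)) := by
  have hli : LinearIndependent K (Matrix.vandermonde θ).col :=
    Matrix.linearIndependent_cols_of_det_ne_zero (Matrix.det_vandermonde_ne_zero_iff.2 hθ)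
  -- Functions on the nodes are identified with polynomials of degree at most d, and `m` is the
  -- monomial basis.
  let m := basisOfLinearIndependentOfCardEqFinrank hli (by simp)
  have hm : ∀ k i, m k i = θ i ^ (k : ℕ) := fun k i => by
    simp [m, Matrix.vandermonde_apply]
  have hrepr : ∀ p : K[X], p.natDegree < d + 1 → ∀ k,
      m.repr (fun i => p.eval (θ i)) k = p.coeff k := by
    intro p hp k
    have h1 : (fun i => p.eval (θ i)) = ∑ k : Fin (d + 1), p.coeff k • m k := by
      funext i
      rw [eval_eq_sum_range' hp, ← Fin.sum_univ_eq_sum_range fun k => p.coeff k * θ i ^ k]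
      simp [hm]
    rw [h1, m.repr_sum_self fun k : Fin (d + 1) => p.coeff k]
  have htri : IsTriangularFamily m fun j i => (f j).eval (θ i) := by
    constructor
    · intro i j hij
      rw [hrepr _ (by rw [hf.natDegree_eq]; exact j.2)]
      exact coeff_eq_zero_of_natDegree_lt (by rw [hf.natDegree_eq]; exact hij)
    · intro i
      rw [hrepr _ (by rw [hf.natDegree_eq]; exact i.2)]
      exact hf.coeff_ne_zero i
  obtain ⟨c, hc⟩ := htri.exists_basis
  have htri' : IsTriangularFamily m c := by rwa [← funext hc] at htri
  have happ : ∀ j, Matrix.toLin' (Matrix.diagonal θ) (c j) =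
      fun i => (X * f j).eval (θ i) := by
    intro j
    funext i
    rw [Matrix.toLin'_apply, Matrix.mulVec_diagonal, hc, eval_mul, eval_X]
  have hdeg : ∀ j : Fin (d + 1), (X * f j).natDegree = (j : ℕ) + 1 := fun j => by
    rw [natDegree_X_mul, hf.natDegree_eq]
    intro h0
    simpa [h0] using hf.2 j
  -- The bound excludes j = d, where X f_d has degree d + 1 and its coefficients are no longer the
  -- `m`-coordinates; no Hessenberg condition concerns that column.
  have hcoeff : ∀ j k : Fin (d + 1), (j : ℕ) + 1 < d + 1 →
      m.repr (Matrix.toLin' (Matrix.diagonal θ) (c j)) k = (X * f j).coeff k := by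
    intro j k hj
    rw [happ, hrepr]
    rwa [hdeg]
  refine ⟨c, fun j i => by rw [hc], fun i j => ⟨fun hij => ?_, fun hij h0 => ?_⟩⟩
  · have hj : (j : ℕ) + 1 < d + 1 := hij.trans i.2
    refine (htri'.repr_eq_zero_iff _ ⟨j + 1, hj⟩).1 (fun k hk => ?_) i (Fin.lt_def.2 hij)
    rw [hcoeff j k hj]
    exact coeff_eq_zero_of_natDegree_lt (by rw [hdeg]; exact Fin.lt_def.1 hk)
  · have hj : (j : ℕ) + 1 < d + 1 := hij ▸ i.2
    have h1 : ∀ k, i < k → c.repr (Matrix.toLin' (Matrix.diagonal θ) (c j)) k = 0 := by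
      refine (htri'.repr_eq_zero_iff _ i).1 fun k hk => ?_
      rw [hcoeff j k hj]
      exact coeff_eq_zero_of_natDegree_lt (by rw [hdeg, ← hij]; exact Fin.lt_def.1 hk)
    -- If the subdiagonal entry vanished, X f_j would lie in the flag of level j, contradicting its
    -- nonzero coefficient of degree j + 1.
    have h2 : m.repr (Matrix.toLin' (Matrix.diagonal θ) (c j)) i = 0 := by
      refine (htri'.repr_eq_zero_iff
        (Matrix.toLin' (Matrix.diagonal θ) (c j)) j).2 (fun k hk => ?_) i (Fin.lt_def.2 (by omega))
      rcases eq_or_ne k i with rfl | hki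
      · exact h0
      · refine h1 k (Fin.lt_def.2 ?_)
        have := Fin.lt_def.1 hk
        have := Fin.val_ne_of_ne hki
        omega
    rw [hcoeff j i hj, hij, coeff_X_mul] at h2
    exact hf.coeff_ne_zero j h2

namespace THSystem

variable {K : Type u} [Field K] {d : ℕ}

/-- The projections onto the lines spanned by the members of a basis. -/
noncomputable def _root_.Module.Basis.lineProj {V : Type*} [AddCommGroup V] [Module K V]
    (b : Module.Basis (Fin (d + 1)) K V) (i : Fin (d + 1)) : Module.End K V :=
  (b.coord i).smulRight (b i)

theorem exists_isTransition (Ω : NormalizedWSVSystem K d) :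
    ∃ Φ : THSystem K d, Φ.IsTransition Ω := by
  obtain ⟨hθ, f, hf, hfX⟩ := Ω.west.2
  obtain ⟨hθs, g, hg, hgX⟩ := Ω.south.2
  obtain ⟨c, hc, hcA⟩ := exists_basis_isHessenbergOn hθ hf
  obtain ⟨r, hr, hrA⟩ := exists_basis_isHessenbergOn hθs hg
  have hcX : ∀ j i, c j i = Ω.X i j := fun j i => by
    rw [hc, hfX, Ω.west_normalized, one_mul]
  have hrX : ∀ j i, r j i = Ω.X j.rev i := fun j i => by
    have h1 : ∀ i, rotateClockwise Ω.X i 0 = 1 := fun i => by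
      simpa [rotateClockwise] using Ω.south_normalized i
    have h2 := hgX i j
    rw [h1, one_mul] at h2
    rw [hr, ← h2]
    rfl
  -- `r` lists the rows of X from the bottom up. `N` expands row i of X diag(θ*) in the rows of X,
  -- so N X = X diag(θ*) and the columns of X are eigenvectors of `N`.
  let N : Matrix (Fin (d + 1)) (Fin (d + 1)) K := Matrix.of fun i k =>
    r.repr (Matrix.toLin' (Matrix.diagonal Ω.θs) (r i.rev)) k.rev
  let b : Module.Basis (Fin (d + 1)) K (Fin (d + 1) → K) := Pi.basisFun K (Fin (d + 1))
  have hb : IsEigenbasis (Matrix.toLin' (Matrix.diagonal Ω.θ)) Ω.θ b.lineProj b := by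
    refine ⟨fun i => ?_, fun i x => rfl⟩
    funext k
    rw [Matrix.toLin'_apply, Matrix.mulVec_diagonal]
    rcases eq_or_ne k i with rfl | hk
    · simp [b]
    · simp [b, hk]
  have hN : ∀ j, Matrix.toLin' N (c j) = Ω.θs j • c j := by
    intro j
    funext i
    have h1 := congr_fun (r.sum_repr (Matrix.toLin' (Matrix.diagonal Ω.θs) (r i.rev))) j
    rw [← Equiv.sum_comp Fin.revPerm, Finset.sum_apply, Matrix.toLin'_apply,
      Matrix.mulVec_diagonal, hrX, Fin.rev_rev] at h1
    rw [Matrix.toLin'_apply, Pi.smul_apply, hcX, smul_eq_mul, ← h1, Matrix.mulVec,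
      dotProduct]
    refine Finset.sum_congr rfl fun k _ => ?_
    rw [hcX, Pi.smul_apply, hrX, Fin.revPerm_apply, Fin.rev_rev]
    rfl
  have hcN : IsEigenbasis (Matrix.toLin' N) Ω.θs c.lineProj c := ⟨hN, fun i x => rfl⟩
  -- `N` is the transpose of the matrix of diag(θ*) in `r` with both indices reversed, an operation
  -- that preserves i - j and hence the Hessenberg shape.
  have hbN : IsHessenbergOn b (Matrix.toLin' N) := by
    have h1 : ∀ i j, b.repr (Matrix.toLin' N (b j)) i =
        r.repr (Matrix.toLin' (Matrix.diagonal Ω.θs) (r i.rev)) j.rev := fun i j => by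
      simp [b, N]
    intro i j
    rw [h1]
    refine ⟨fun hij => (hrA _ _).1 ?_, fun hij => (hrA _ _).2 ?_⟩
    · simp only [Fin.val_rev]; omega
    · simp only [Fin.val_rev]; omega
  let Φ : THSystem K d := {
    V := Fin (d + 1) → K
    finrank_eq := (Module.finrank_fintype_fun_eq_card K).trans (Fintype.card_fin _)
    A := Matrix.toLin' (Matrix.diagonal Ω.θ)
    E := b.lineProj
    Astar := Matrix.toLin' N
    Estar := c.lineProj
    multiplicityFree := hb.isMultiplicityFree hθ
    multiplicityFree_star := hcN.isMultiplicityFree hθs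
    ordering := ⟨_, hb.isPrimitiveIdempotentOrdering hθ⟩
    ordering_star := ⟨_, hcN.isPrimitiveIdempotentOrdering hθs⟩
    hessenberg := (hb.hessenbergCondition_iff _).2 hbN
    hessenberg_star := (hcN.hessenbergCondition_iff _).2 hcA }
  have hcb : ∀ j, c j = ∑ i, Ω.X i j • b i := fun j => by
    funext i
    simp [b, hcX, Pi.single_apply]
  exact ⟨Φ, b, c, hb, hcN, hcb⟩

end THSystem

/-! ### Passing to isomorphism classes and affine classes -/

theorem corollary19p12 {K : Type u} [Field K] (d : ℕ) :
    ∃ ρ : THSystem.IsoClass K d → NormalizedWSVSystem K d,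
      (∀ (Φ : THSystem K d) (Ω : NormalizedWSVSystem K d), ρ Φ.isoClass = Ω ↔ IsRhoImage Φ Ω) ∧
      Function.Bijective ρ ∧
      ∃ ρAff : THSystem.AffineClass K d → NormalizedWSVSystem.AffineClass K d,
        (∀ Φ : THSystem K d, ρAff Φ.affineClass = (ρ Φ.isoClass).affineClass) ∧
        Function.Bijective ρAff := by
  have hex : ∀ Φ : THSystem K d, ∃ Ω, Φ.IsTransition Ω := fun Φ =>
    Φ.exists_isRhoImage_isTransition.imp fun _ h => h.2
  choose F hF using hex
  have hFiso : ∀ Φ Ψ : THSystem K d, THSystem.Isomorphic Φ Ψ ↔ F Φ = F Ψ := fun Φ Ψ =>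
    ⟨fun h => ((hF Φ).of_isomorphic h).unique (hF Ψ),
      fun h => (hF Φ).isomorphic (h ▸ hF Ψ)⟩
  have hFaff : ∀ (Φ : THSystem K d) (α β αs βs : K) (hα : α ≠ 0) (hαs : αs ≠ 0),
      F (Φ.affine α β αs βs hα hαs) = (F Φ).affine α β αs βs hα hαs :=
    fun Φ α β αs βs hα hαs => (hF _).unique ((hF Φ).affine α β αs βs hα hαs)
  -- `F` separates isomorphism classes and commutes with affine changes, so both affine relations
  -- become the same statement with the same scalars.
  have hFrel : ∀ Φ Ψ : THSystem K d, THSystem.AffineIsomorphic Φ Ψ ↔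
      NormalizedWSVSystem.AffineRelated (F Φ) (F Ψ) := fun Φ Ψ => by
    simp only [THSystem.AffineIsomorphic, NormalizedWSVSystem.AffineRelated, hFiso, hFaff]
  have hFsurj : Function.Surjective F := fun Ω => by
    obtain ⟨Φ, hΦ⟩ := THSystem.exists_isTransition Ω
    exact ⟨Φ, (hF Φ).unique hΦ⟩
  refine ⟨Quotient.lift F fun Φ Ψ h => (hFiso Φ Ψ).1 h, fun Φ Ω => ?_, ⟨?_, fun Ω => ?_⟩,
    Quotient.map' F fun Φ Ψ h => (hFrel Φ Ψ).1 h, fun Φ => rfl, ?_, fun Ω => ?_⟩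
  · rw [THSystem.isRhoImage_iff_isTransition]
    exact ⟨fun h => h ▸ hF Φ, fun h => (hF Φ).unique h⟩
  · rintro ⟨Φ⟩ ⟨Ψ⟩ h
    exact Quotient.sound ((hFiso Φ Ψ).2 h)
  · obtain ⟨Φ, hΦ⟩ := hFsurj Ω
    exact ⟨Φ.isoClass, hΦ⟩
  · rintro ⟨Φ⟩ ⟨Ψ⟩ h
    exact Quotient.sound ((hFrel Φ Ψ).2 (Quotient.exact h))
  · induction Ω using Quotient.inductionOn with
    | h Ω =>
      obtain ⟨Φ, rfl⟩ := hFsurj Ω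
      exact ⟨Φ.affineClass, rfl⟩
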